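/- Conventions. The ordinal $0$ counts as a limit ordinal. A cardinal is identified with its initial ordinal. Let $\kappa$ be either an infinite regular cardinal or the symbol $\infty$, which is greater than every cardinal and every ordinal. For a set $X$ let $\mathcal P_{<\kappa}X$ be the set of subsets of $X$ of cardinality less than $\kappa$ (all subsets if $\kappa=\infty$); this is an endofunctor of $\mathbf{Set}$ via direct image. The final chain of $F=\mathcal P_{<\kappa}$ consists of sets $\nu_iF$ ($i$ an ordinal) and connecting maps $\nu^j_i\colon \nu_iF\to\nu_jF$ ($j\le i$), functorial in the sense that $\nu^i_i=\mathrm{id}$ and $\nu^k_j\nu^j_i=\nu^k_i$, defined by: $\nu_{i+1}F=F\,\nu_iF$ and $\nu^{j+1}_{i+1}=F\nu^j_i$; for a limit $i$, $\nu_iF$ is the set of families $(x_j)_{j<i}$ with $x_j\in\nu_jF$ and $\nu^k_jx_j=x_k$ for $k\le j<i$, and $\nu^j_i$ is the $j$-th projection for $j<i$. For an $F$-coalgebra $\zeta\colon X\to FX$ the projections $p_i\colon X\to\nu_iF$ are given by $p_{i+1}=Fp_i\circ\zeta$ and, for a limit $i$, $p_i(x)=(p_j(x))_{j<i}$. An element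 of $\nu_iF$ is $F$-coalgebraic if it is $p_i(x)$ for some $F$-coalgebra $(X,\zeta)$ and some $x\in X$. Every ordinal $i$ is uniquely $l+m$ with $l$ a limit and $m\in\mathbb N$; $l$ is called the limit part of $i$. An ordinal is $\omega$-cofinal if it is the supremum of a strictly increasing sequence $(i_n)_{n\in\mathbb N}$ of ordinals. A regular infinite cardinal $\lambda$ is weakly compact if $|\mathcal P A|<\lambda$ for every set $A$ with $|A|<\lambda$ (so $\aleph_0$ is allowed) and $\lambda$ has the tree property: every tidy $\lambda$-tree all of whose levels have cardinality less than $\lambda$ has a full branch. Here a tidy $\lambda$-tree is a family of sets $(D_i)_{i<\lambda}$ with functorial surjective connecting maps $D_i\to D_j$ ($j\le i<\lambda$) such that $D_0$ is nonempty and, for every limit $i<\lambda$, an element of $D_i$ is determined by its images in the $D_j$, $j<i$; a full branch is a compatible family $(x_i)_{i<\lambda}$ with $x_i\in D_i$. Say that a limit ordinal $l$ is good if $l\ne\kappa$ and at least one of the following holds: $l=0$; $l$ is $\omega$-cofinal; $l$ is a weakly compact cardinal; $\kappa<\infty$ and $l\ge\kappa+\omega$. Claim. (1) For all ordinals $j\le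 i$, the connecting map $\nu^j_i\colon\nu_i\mathcal P_{<\kappa}\to\nu_j\mathcal P_{<\kappa}$ is surjective if and only if $j=i$ or the limit part of $j$ is good. (2) For every ordinal $i$, every element of $\nu_i\mathcal P_{<\kappa}$ is $\mathcal P_{<\kappa}$-coalgebraic if and only if the limit part of $i$ is good. -/

import Mathlib

universe u v

noncomputable section

open Cardinal Order

namespace FinalChain

/-! ### Inverse chains and full branches -/

/-- An inverse `I`-chain: levels, and functorial connecting maps from higher to lower levels. -/
structure InverseChain (I : Type v) [Preorder I] where
  level : I → Type u
  conn : ∀ {j i : I}, j ≤ i → level i → level j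
  conn_self : ∀ (i : I) (x : level i), conn (le_refl i) x = x
  conn_conn : ∀ {k j i : I} (hkj : k ≤ j) (hji : j ≤ i) (x : level i),
    conn hkj (conn hji x) = conn (hkj.trans hji) x

/-- A full branch: a compatible choice of an element at every level. -/
def InverseChain.FullBranch {I : Type v} [Preorder I] (D : InverseChain.{u, v} I) :
    Type (max u v) :=
  {x : ∀ i, D.level i // ∀ (j i : I) (h : j ≤ i), D.conn h (x i) = x j}

/-- The restriction of an inverse `Ord`-chain to the ordinals below `i`. -/
def InverseChain.below (D : InverseChain.{u, u + 1} Ordinal.{u}) (i : Ordinal.{u}) :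
    InverseChain.{u, u + 1} (Set.Iio i) where
  level j := D.level j.1
  conn h := D.conn h
  conn_self _ := D.conn_self _
  conn_conn _ _ := D.conn_conn _ _

/-! ### Ordinals and cardinals

The ordinal `0` counts as a limit (`Order.IsSuccPrelimit`).  A cardinal `c` is identified with its
initial ordinal `c.ord`. -/

/-- The limit part of an ordinal. -/
def limitPart (i : Ordinal.{u}) : Ordinal.{u} := Ordinal.omega0 * (i / Ordinal.omega0)

/-- `limitPart i` is the unique limit `l` (possibly `0`) with `i = l + m` for a natural `m`. -/
theorem limitPart_eq_iff (i l : Ordinal.{u}) :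
    limitPart i = l ↔ IsSuccPrelimit l ∧ ∃ m : ℕ, i = l + m := by
  constructor
  · rintro rfl
    refine ⟨Ordinal.isSuccPrelimit_iff_omega0_dvd.2 ⟨_, rfl⟩, ?_⟩
    obtain ⟨m, hm⟩ := Ordinal.lt_omega0.1 (Ordinal.mod_lt i Ordinal.omega0_ne_zero)
    exact ⟨m, by rw [← hm, limitPart, Ordinal.div_add_mod]⟩
  · rintro ⟨hl, m, rfl⟩
    obtain ⟨b, rfl⟩ := Ordinal.isSuccPrelimit_iff_omega0_dvd.1 hl
    rw [limitPart, Ordinal.mul_add_div _ Ordinal.omega0_ne_zero,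
      Ordinal.div_eq_zero_of_lt (Ordinal.natCast_lt_omega0 m), add_zero]

/-- An ordinal is `ω`-cofinal when it is the supremum of a strictly increasing `ω`-sequence. -/
def IsOmegaCofinal (i : Ordinal.{u}) : Prop :=
  ∃ f : ℕ → Ordinal.{u}, StrictMono f ∧ IsLUB (Set.range f) i

/-- Tidy trees of height `o`: inverse chains indexed by the ordinals below `o`, with surjective
connecting maps, with at most one extension at `i` of each full branch through the levels below
a limit `i`, and with a root. -/
structure InverseChain.IsTidyTree {o : Ordinal.{u}}
    (D : InverseChain.{u, u + 1} (Set.Iio o)) : Prop where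
  surjective : ∀ (j i : Set.Iio o) (h : j ≤ i), Function.Surjective (D.conn h)
  limit_ext : ∀ i : Set.Iio o, IsSuccPrelimit (i : Ordinal.{u}) → ∀ x y : D.level i,
    (∀ (j : Set.Iio o) (h : j < i), D.conn h.le x = D.conn h.le y) → x = y
  root : ∀ i : Set.Iio o, (i : Ordinal.{u}) = 0 → Nonempty (D.level i)

/-- The tree property: every tidy `c`-tree with all levels `<c`-sized has a full branch. -/
def HasTreeProperty (c : Cardinal.{u}) : Prop :=
  ∀ D : InverseChain.{u, u + 1} (Set.Iio c.ord), D.IsTidyTree → (∀ i, #(D.level i) < c) →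
    Nonempty D.FullBranch

/-- Weakly compact cardinals: infinite, regular, strongly inaccessible (here `ℵ₀` is allowed),
with the tree property. -/
structure IsWeaklyCompact (c : Cardinal.{u}) : Prop where
  regular : c.IsRegular
  powerset_lt : ∀ A : Type u, #A < c → #(Set A) < c
  tree : HasTreeProperty c

/-! ### The functor `P_{<κ}`

Here `κ` is a cardinal or `⊤`, which lies above every cardinal. -/

/-- `κ` is infinite and regular; `⊤` is deemed to be so. -/
def IsRegularOrTop (κ : WithTop Cardinal.{u}) : Prop :=
  ∀ c : Cardinal.{u}, κ = c → c.IsRegular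

/-- The set of `<κ`-sized subsets of `X`. -/
def PowLT (κ : WithTop Cardinal.{u}) (X : Type u) : Type u :=
  {s : Set X // ((#s : Cardinal.{u}) : WithTop Cardinal.{u}) < κ}

namespace PowLT

variable {κ : WithTop Cardinal.{u}} {X Y Z : Type u}

/-- The action of `P_{<κ}` on functions, by direct image. -/
def map (f : X → Y) (s : PowLT κ X) : PowLT κ Y :=
  ⟨f '' s.1, lt_of_le_of_lt (WithTop.coe_le_coe.2 mk_image_le) s.2⟩

theorem map_congr {f g : X → Y} {s : PowLT κ X} (h : ∀ x ∈ s.1, f x = g x) :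
    map f s = map g s :=
  Subtype.ext (Set.image_congr h)

theorem map_id' {f : X → X} {s : PowLT κ X} (h : ∀ x ∈ s.1, f x = x) : map f s = s :=
  Subtype.ext ((Set.image_congr h).trans (Set.image_id' s.1))

theorem map_map (g : Y → Z) (f : X → Y) (s : PowLT κ X) :
    map g (map f s) = map (fun x => g (f x)) s :=
  Subtype.ext (Set.image_image g f s.1)

theorem map_injective {f : X → Y} (hf : Function.Injective f) :
    Function.Injective (map f : PowLT κ X → PowLT κ Y) := fun _ _ h =>
  Subtype.ext (hf.image_injective (congrArg Subtype.val h))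

end PowLT

/-! ### The final chain of `P_{<κ}`

`Pre κ i` is the `i`-th level without the compatibility condition on the tuples that occur at limit
stages; `Compat` is that condition, imposed hereditarily. -/

section Construction

variable (κ : WithTop Cardinal.{u})

/-- `P_{<κ}` is applied at successors; the product of the earlier stages is taken at limits. -/
def Pre (i : Ordinal.{u}) : Type u :=
  SuccOrder.prelimitRecOn (motive := fun _ => Type u) i
    (fun _ _ T => PowLT κ T)
    (fun i _ T => Shrink.{u} (∀ j : Set.Iio i, T j.1 j.2))

theorem pre_succ (i : Ordinal.{u}) : Pre κ (succ i) = PowLT κ (Pre κ i) :=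
  SuccOrder.prelimitRecOn_succ (motive := fun _ => Type u) _ _ i

theorem pre_limit {i : Ordinal.{u}} (hi : IsSuccPrelimit i) :
    Pre κ i = Shrink.{u} (∀ j : Set.Iio i, Pre κ j.1) :=
  SuccOrder.prelimitRecOn_of_isSuccPrelimit (motive := fun _ => Type u) _ _ hi

variable {κ}

/-- An element of a successor stage as a subset of the previous stage. -/
def elts {i : Ordinal.{u}} : Pre κ (succ i) ≃ PowLT κ (Pre κ i) :=
  Equiv.cast (pre_succ κ i)

/-- An element of a limit stage as a tuple of elements of the earlier stages. -/
def comps {i : Ordinal.{u}} (hi : IsSuccPrelimit i) :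
    Pre κ i ≃ (∀ j : Set.Iio i, Pre κ j.1) :=
  (Equiv.cast (pre_limit κ hi)).trans (equivShrink _).symm

open scoped Classical in
/-- The connecting maps on `Pre κ`: direct image of an earlier connecting map between successors,
projection out of a limit, and tupling of the earlier connecting maps into a limit. -/
def res (i : Ordinal.{u}) : ∀ j : Ordinal.{u}, j ≤ i → Pre κ i → Pre κ j :=
  SuccOrder.prelimitRecOn (motive := fun i => ∀ j : Ordinal.{u}, j ≤ i → Pre κ i → Pre κ j) i
    (fun i _ ih j => SuccOrder.prelimitRecOn
      (motive := fun j => j ≤ succ i → Pre κ (succ i) → Pre κ j) j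
      (fun j _ _ h x => elts.symm (PowLT.map (ih j (succ_le_succ_iff.1 h)) (elts x)))
      (fun _ hj r h x => (comps hj).symm fun k => r k.1 k.2 (le_of_lt k.2 |>.trans h) x))
    (fun _ hi _ j h x => if e : j = _ then cast (congrArg (Pre κ) e.symm) x
      else comps hi x ⟨j, lt_of_le_of_ne h e⟩)

theorem res_succ_succ {i j : Ordinal.{u}} (h : succ j ≤ succ i) (x : Pre κ (succ i)) :
    res (succ i) (succ j) h x
      = elts.symm (PowLT.map (res i j (succ_le_succ_iff.1 h)) (elts x)) := by
  unfold res
  rw [SuccOrder.prelimitRecOn_succ, SuccOrder.prelimitRecOn_succ]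

theorem res_succ_limit {i j : Ordinal.{u}} (hj : IsSuccPrelimit j) (h : j ≤ succ i)
    (x : Pre κ (succ i)) :
    res (succ i) j h x
      = (comps hj).symm fun k => res (succ i) k.1 (le_of_lt k.2 |>.trans h) x := by
  unfold res
  rw [SuccOrder.prelimitRecOn_succ, SuccOrder.prelimitRecOn_of_isSuccPrelimit _ _ hj]

theorem res_limit_self {i : Ordinal.{u}} (hi : IsSuccPrelimit i) (x : Pre κ i) :
    res i i le_rfl x = x := by
  unfold res
  rw [SuccOrder.prelimitRecOn_of_isSuccPrelimit _ _ hi]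
  simp

theorem res_limit {i j : Ordinal.{u}} (hi : IsSuccPrelimit i) (h : j < i) (x : Pre κ i) :
    res i j h.le x = comps hi x ⟨j, h⟩ := by
  unfold res
  rw [SuccOrder.prelimitRecOn_of_isSuccPrelimit _ _ hi]
  simp [h.ne]

/-- Hereditary compatibility: the tuples at limit stages are full branches. -/
def Compat (i : Ordinal.{u}) : Pre κ i → Prop :=
  SuccOrder.prelimitRecOn (motive := fun i => Pre κ i → Prop) i
    (fun _ _ ih x => ∀ y ∈ (elts x).1, ih y)
    (fun i hi ih x => (∀ j : Set.Iio i, ih j.1 j.2 (comps hi x j)) ∧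
      ∀ (j k : Set.Iio i) (h : j ≤ k), res k.1 j.1 h (comps hi x k) = comps hi x j)

theorem compat_succ {i : Ordinal.{u}} {x : Pre κ (succ i)} :
    Compat (succ i) x ↔ ∀ y ∈ (elts x).1, Compat i y := by
  unfold Compat
  rw [SuccOrder.prelimitRecOn_succ]

theorem compat_limit {i : Ordinal.{u}} (hi : IsSuccPrelimit i) {x : Pre κ i} :
    Compat i x ↔ (∀ j : Set.Iio i, Compat j.1 (comps hi x j)) ∧
      ∀ (j k : Set.Iio i) (h : j ≤ k), res k.1 j.1 h (comps hi x k) = comps hi x j := by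
  unfold Compat
  rw [SuccOrder.prelimitRecOn_of_isSuccPrelimit _ _ hi]

theorem res_self {i : Ordinal.{u}} (x : Pre κ i) : res i i le_rfl x = x := by
  induction i using SuccOrder.prelimitRecOn with
  | succ i _ ih => rw [res_succ_succ, PowLT.map_id' fun y _ => ih y, Equiv.symm_apply_apply]
  | isSuccPrelimit i hi _ => exact res_limit_self hi x

theorem res_compat_and_comp {i : Ordinal.{u}} (x : Pre κ i) (hx : Compat i x) :
    ∀ (j : Ordinal.{u}) (hj : j ≤ i), Compat j (res i j hj x) ∧
      ∀ (k : Ordinal.{u}) (hk : k ≤ j), res j k hk (res i j hj x) = res i k (hk.trans hj) x := by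
  induction i using SuccOrder.prelimitRecOn with
  | succ i _ ih =>
    have ih' := fun y hy => ih y (compat_succ.1 hx y hy)
    intro j
    induction j using SuccOrder.prelimitRecOn with
    | succ j _ _ =>
      intro hj
      refine ⟨?_, ?_⟩
      · rw [compat_succ, res_succ_succ, Equiv.apply_symm_apply]
        rintro _ ⟨y, hy, rfl⟩
        exact (ih' y hy j _).1
      · intro k
        induction k using SuccOrder.prelimitRecOn with
        | succ k _ _ =>
          intro hk
          simp only [res_succ_succ, Equiv.apply_symm_apply, PowLT.map_map]
          exact congrArg _ (PowLT.map_congr fun y hy =>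
            (ih' y hy j (succ_le_succ_iff.1 hj)).2 k (succ_le_succ_iff.1 hk))
        | isSuccPrelimit k hk' ihk =>
          intro hk
          rw [res_succ_limit hk' hk, res_succ_limit hk' (hk.trans hj)]
          exact congrArg _ (funext fun l => ihk l.1 l.2 _)
    | isSuccPrelimit j hj' ihj =>
      intro hj
      refine ⟨?_, ?_⟩
      · rw [compat_limit hj', res_succ_limit hj' hj, Equiv.apply_symm_apply]
        exact ⟨fun l => (ihj l.1 l.2 _).1, fun l m h => (ihj m.1 m.2 _).2 l.1 h⟩
      · intro k hk
        rcases hk.lt_or_eq with h | rfl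
        · rw [res_limit hj' h, res_succ_limit hj' hj, Equiv.apply_symm_apply]
        · exact res_self _
  | isSuccPrelimit i hi ih =>
    intro j hj
    rcases hj.lt_or_eq with h | rfl
    · have hc := (compat_limit hi).1 hx
      rw [res_limit hi h]
      refine ⟨hc.1 ⟨j, h⟩, fun k hk => ?_⟩
      rw [res_limit hi (hk.trans_lt h)]
      exact hc.2 ⟨k, hk.trans_lt h⟩ ⟨j, h⟩ hk
    · rw [res_self]
      exact ⟨hx, fun _ _ => rfl⟩

end Construction

/-- The final chain of `P_{<κ}`. -/
def finalChain (κ : WithTop Cardinal.{u}) : InverseChain.{u, u + 1} Ordinal.{u} where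
  level i := {x : Pre κ i // Compat i x}
  conn {j i} h x := ⟨res i j h x.1, (res_compat_and_comp x.1 x.2 j h).1⟩
  conn_self _ x := Subtype.ext (res_self x.1)
  conn_conn {k _ _} hkj hji x := Subtype.ext ((res_compat_and_comp x.1 x.2 _ hji).2 k hkj)

section Clauses

variable {κ : WithTop Cardinal.{u}}

/-- First defining clause: the level at `i + 1` is `P_{<κ}` of the level at `i`. -/
def finalChainSucc (i : Ordinal.{u}) :
    PowLT κ ((finalChain κ).level i) ≃ (finalChain κ).level (succ i) :=
  Equiv.ofBijective
    (fun s => ⟨elts.symm (PowLT.map Subtype.val s), compat_succ.2 (by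
      rw [Equiv.apply_symm_apply]
      rintro _ ⟨y, _, rfl⟩
      exact y.2)⟩)
    ⟨fun _ _ h => PowLT.map_injective Subtype.val_injective
      (elts.symm.injective (congrArg Subtype.val h)), fun x => by
      refine ⟨⟨Subtype.val ⁻¹' (elts x.1).1, lt_of_le_of_lt (WithTop.coe_le_coe.2
        (mk_preimage_of_injective _ _ Subtype.val_injective)) (elts x.1).2⟩, Subtype.ext ?_⟩
      refine (Equiv.symm_apply_eq _).2 (Subtype.ext ?_)
      refine (Set.image_preimage_eq_iff).2 fun y hy => ?_
      exact ⟨⟨y, compat_succ.1 x.2 y hy⟩, rfl⟩⟩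

/-- Second defining clause: the connecting map from `i + 1` to `j + 1` is `P_{<κ}` of the connecting
map from `i` to `j`. -/
theorem conn_finalChainSucc {j i : Ordinal.{u}} (h : j ≤ i)
    (s : PowLT κ ((finalChain κ).level i)) :
    (finalChain κ).conn (succ_le_succ h) (finalChainSucc i s)
      = finalChainSucc j (PowLT.map ((finalChain κ).conn h) s) := by
  refine Subtype.ext ?_
  change res (succ i) (succ j) _ (elts.symm (PowLT.map Subtype.val s))
    = elts.symm (PowLT.map Subtype.val (PowLT.map _ s))
  rw [res_succ_succ, Equiv.apply_symm_apply]
  exact congrArg elts.symm ((PowLT.map_map _ _ s).trans (PowLT.map_map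
    (Subtype.val : {y : Pre κ j // Compat j y} → Pre κ j) ((finalChain κ).conn h) s).symm)

/-- Third defining clause: at a limit `i`, the level is the set of full branches through the
earlier levels, the connecting maps being the projections. -/
theorem finalChain_limit {i : Ordinal.{u}} (hi : IsSuccPrelimit i) :
    Function.Bijective (fun x : (finalChain κ).level i =>
      (⟨fun j => (finalChain κ).conn (le_of_lt j.2) x, fun _ _ _ => (finalChain κ).conn_conn _ _ _⟩ :
        ((finalChain κ).below i).FullBranch)) := by
  constructor
  · intro x y h
    refine Subtype.ext ((comps hi).injective (funext fun j => ?_))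
    have := congrArg Subtype.val (congrFun (congrArg Subtype.val h) j)
    change res i j.1 (le_of_lt j.2) x.1 = res i j.1 (le_of_lt j.2) y.1 at this
    rwa [res_limit hi j.2, res_limit hi j.2] at this
  · intro b
    refine ⟨⟨(comps hi).symm fun j => (b.1 j).1, (compat_limit hi).2 ?_⟩, ?_⟩
    · rw [Equiv.apply_symm_apply]
      exact ⟨fun j => (b.1 j).2, fun j k h => congrArg Subtype.val (b.2 j k h)⟩
    · refine Subtype.ext (funext fun j => Subtype.ext ?_)
      change res i j.1 (le_of_lt j.2) ((comps hi).symm _) = _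
      rw [res_limit hi j.2, Equiv.apply_symm_apply]

end Clauses

/-! ### Coalgebra projections -/

section Coalgebra

variable {κ : WithTop Cardinal.{u}} {X : Type u}

/-- The `i`-th projection of a `P_{<κ}`-coalgebra, with values in `Pre κ i`. -/
def preProj (ζ : X → PowLT κ X) (i : Ordinal.{u}) : X → Pre κ i :=
  SuccOrder.prelimitRecOn (motive := fun i => X → Pre κ i) i
    (fun _ _ p x => elts.symm (PowLT.map p (ζ x)))
    (fun _ hi p x => (comps hi).symm fun j => p j.1 j.2 x)

theorem preProj_succ (ζ : X → PowLT κ X) (i : Ordinal.{u}) (x : X) :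
    preProj ζ (succ i) x = elts.symm (PowLT.map (preProj ζ i) (ζ x)) := by
  unfold preProj
  rw [SuccOrder.prelimitRecOn_succ]

theorem preProj_limit (ζ : X → PowLT κ X) {i : Ordinal.{u}} (hi : IsSuccPrelimit i) (x : X) :
    preProj ζ i x = (comps hi).symm fun j => preProj ζ j.1 x := by
  unfold preProj
  rw [SuccOrder.prelimitRecOn_of_isSuccPrelimit _ _ hi]

theorem res_preProj (ζ : X → PowLT κ X) (i : Ordinal.{u}) :
    ∀ (j : Ordinal.{u}) (h : j ≤ i) (x : X), res i j h (preProj ζ i x) = preProj ζ j x := by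
  induction i using SuccOrder.prelimitRecOn with
  | succ i _ ih =>
    intro j
    induction j using SuccOrder.prelimitRecOn with
    | succ j _ _ =>
      intro h x
      rw [res_succ_succ, preProj_succ, preProj_succ, Equiv.apply_symm_apply, PowLT.map_map]
      exact congrArg _ (PowLT.map_congr fun y _ => ih j _ y)
    | isSuccPrelimit j hj ihj =>
      intro h x
      rw [res_succ_limit hj, preProj_limit ζ hj]
      exact congrArg _ (funext fun k => ihj k.1 k.2 _ x)
  | isSuccPrelimit i hi _ =>
    intro j h x
    rcases h.lt_or_eq with h | rfl
    · rw [res_limit hi h, preProj_limit ζ hi, Equiv.apply_symm_apply]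
    · exact res_self _

theorem compat_preProj (ζ : X → PowLT κ X) (i : Ordinal.{u}) :
    ∀ x : X, Compat i (preProj ζ i x) := by
  induction i using SuccOrder.prelimitRecOn with
  | succ i _ ih =>
    intro x
    rw [compat_succ, preProj_succ, Equiv.apply_symm_apply]
    rintro _ ⟨y, _, rfl⟩
    exact ih y
  | isSuccPrelimit i hi ih =>
    intro x
    rw [compat_limit hi, preProj_limit ζ hi, Equiv.apply_symm_apply]
    exact ⟨fun j => ih j.1 j.2 x, fun j k h => res_preProj ζ k.1 j.1 h x⟩

/-- The `i`-th coalgebra projection of a `P_{<κ}`-coalgebra `ζ : X → P_{<κ} X`. -/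
def proj (ζ : X → PowLT κ X) (i : Ordinal.{u}) (x : X) : (finalChain κ).level i :=
  ⟨preProj ζ i x, compat_preProj ζ i x⟩

/-- Successor clause for the projections. -/
theorem proj_succ (ζ : X → PowLT κ X) (i : Ordinal.{u}) (x : X) :
    proj ζ (succ i) x = finalChainSucc i (PowLT.map (proj ζ i) (ζ x)) := by
  refine Subtype.ext ((preProj_succ ζ i x).trans ?_)
  exact congrArg elts.symm (PowLT.map_map
    (Subtype.val : {y : Pre κ i // Compat i y} → Pre κ i) (proj ζ i) (ζ x)).symm

/-- The projections form a full branch; in particular they are tuples at limits. -/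
theorem conn_proj (ζ : X → PowLT κ X) {j i : Ordinal.{u}} (h : j ≤ i) (x : X) :
    (finalChain κ).conn h (proj ζ i x) = proj ζ j x :=
  Subtype.ext (res_preProj ζ i j h x)

/-- An element of the `i`-th level is `P_{<κ}`-coalgebraic when it is the `i`-th projection of some
pointed `P_{<κ}`-coalgebra. -/
def IsCoalgebraic {i : Ordinal.{u}} (a : (finalChain κ).level i) : Prop :=
  ∃ (X : Type u) (ζ : X → PowLT κ X) (x : X), proj ζ i x = a

end Coalgebra

/-- The condition on a limit ordinal `l`: it is `0`, `ω`-cofinal, weakly compact, or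
at least `κ + ω` (for `κ < ⊤`), and it is different from `κ`. -/
def IsSurjectivityLimit (κ : WithTop Cardinal.{u}) (l : Ordinal.{u}) : Prop :=
  (l = 0 ∨ IsOmegaCofinal l ∨ (∃ c : Cardinal.{u}, l = c.ord ∧ IsWeaklyCompact c) ∨
    ∃ c : Cardinal.{u}, κ = c ∧ c.ord + Ordinal.omega0 ≤ l) ∧
  ∀ c : Cardinal.{u}, κ = c → l ≠ c.ord

end FinalChain

end

open Cardinal Order

noncomputable section

/-! Both claims reduce to `SurjAt κ i`, surjectivity of the single map from level `i + 1` to level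
`i`. A section of that map is a coalgebra on level `i` whose projections are the connecting maps
(`SurjAt.isCoalgebraic`), so every element of level `i` is coalgebraic and therefore lifts to all
higher levels. The functor preserves and reflects surjectivity (`surjAt_succ_iff`), which leaves
limit ordinals `l`.

A point `a` of level `l` is a compatible system of slices, one `<κ`-sized subset of each earlier
level. A preimage of `a` is a `<κ`-sized set of branches through the slices that covers all of them.
For `|l| < κ` it suffices to find a branch through each node (`surjAt_of_fullBranch`): dependent
choice does this for `ω`-cofinal `l`, the tree property for weakly compact `l`. At `l = κ` the point
that imitates the set of all ordinals below `κ` would need `κ` elements (`not_surjAt_ord`). By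
regularity, maps down to level `κ` are injective, so from `κ + ω` on one branch per element of the
slice at `κ` is enough.

Conversely, let `|l| < κ` with `l` neither `0` nor `ω`-cofinal. A tree with no full branch, labelled
by sets of ordinals below `l`, can be encoded into the levels below `l`; a preimage of the resulting
point would decode to a full branch (`TreeCode.not_surjAt`). The tree of finite subsets of a cofinal
set shows that every cofinal subset of `l` has more than `2 ^ |θ|` elements for all `θ < l`, so `l`
is a regular strong limit cardinal. Encoding a counterexample to the tree property then shows that
`l` is weakly compact. -/

namespace FinalChain

/-! ### Levels of the final chain as sets of elements and as families -/

section Levels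

variable {κ : WithTop Cardinal.{u}} {i j k l : Ordinal.{u}}

/-- The `i`-th level of the final chain. -/
abbrev Lev (κ : WithTop Cardinal.{u}) (i : Ordinal.{u}) : Type u := (finalChain κ).level i

/-- The connecting maps of the final chain. -/
abbrev restr (h : j ≤ i) : Lev κ i → Lev κ j := (finalChain κ).conn h

theorem restr_self (h : i ≤ i) (x : Lev κ i) : restr h x = x := (finalChain κ).conn_self i x

theorem restr_restr (hkj : k ≤ j) (hji : j ≤ i) (x : Lev κ i) :
    restr hkj (restr hji x) = restr (hkj.trans hji) x := (finalChain κ).conn_conn hkj hji x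

/-- The set of elements of an element of a successor level. -/
def members (x : Lev κ (succ i)) : Set (Lev κ i) := ((finalChainSucc i).symm x).1

theorem mk_members_lt (x : Lev κ (succ i)) : ((#(members x) : Cardinal.{u}) : WithTop Cardinal) < κ :=
  ((finalChainSucc i).symm x).2

/-- The element of a successor level with a given set of elements. -/
def ofSet (s : Set (Lev κ i)) (hs : ((#s : Cardinal.{u}) : WithTop Cardinal) < κ) :
    Lev κ (succ i) := finalChainSucc i ⟨s, hs⟩

@[simp] theorem members_ofSet (s : Set (Lev κ i)) (hs) : members (ofSet s hs) = s :=
  congrArg Subtype.val ((finalChainSucc i).symm_apply_apply ⟨s, hs⟩)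

theorem members_injective : Function.Injective (members : Lev κ (succ i) → Set (Lev κ i)) :=
  fun _ _ h => (finalChainSucc i).symm.injective (Subtype.ext h)

theorem members_restr_succ (h : j ≤ i) (h' : succ j ≤ succ i) (x : Lev κ (succ i)) :
    members (restr h' x) = restr h '' members x := by
  obtain ⟨s, rfl⟩ := (finalChainSucc i).surjective x
  rw [show restr h' (finalChainSucc i s) = _ from conn_finalChainSucc h s]
  exact (congrArg Subtype.val ((finalChainSucc j).symm_apply_apply _)).trans
    (congrArg (fun t : PowLT κ _ => restr h '' t.1) ((finalChainSucc i).symm_apply_apply s).symm)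

theorem lev_ext (hi : IsSuccPrelimit i) {x y : Lev κ i}
    (h : ∀ (j) (hj : j < i), restr hj.le x = restr hj.le y) : x = y :=
  (finalChain_limit hi).1 (Subtype.ext (funext fun j => h j.1 j.2))

theorem lev_exists (hi : IsSuccPrelimit i) (f : ∀ j < i, Lev κ j)
    (hf : ∀ (j k) (hj : j ≤ k) (hk : k < i), restr hj (f k hk) = f j (hj.trans_lt hk)) :
    ∃ x : Lev κ i, ∀ (j) (hj : j < i), restr hj.le x = f j hj := by
  obtain ⟨x, hx⟩ := (finalChain_limit hi).2 ⟨fun j => f j.1 j.2, fun j k h => hf j.1 k.1 h k.2⟩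
  exact ⟨x, fun j hj => congrFun (congrArg Subtype.val hx) ⟨j, hj⟩⟩

theorem lev_ext_members (hi : IsSuccPrelimit i) {x y : Lev κ i}
    (h : ∀ (j) (hj : succ j < i), members (restr hj.le x) = members (restr hj.le y)) : x = y := by
  refine lev_ext hi fun j hj => ?_
  have := congrArg (restr (le_succ j)) (members_injective (h j (hi.succ_lt hj)))
  rwa [restr_restr, restr_restr] at this

instance : Subsingleton (Lev κ 0) :=
  ⟨fun _ _ => lev_ext Ordinal.isSuccPrelimit_zero fun _ hj => absurd hj not_lt_zero⟩

end Levels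

/-! ### Surjectivity of connecting maps and coalgebraic elements -/

section Coalgebraic

variable {κ : WithTop Cardinal.{u}} {i j : Ordinal.{u}}

/-- The connecting map from level `i + 1` to level `i` is surjective. -/
def SurjAt (κ : WithTop Cardinal.{u}) (i : Ordinal.{u}) : Prop :=
  Function.Surjective (restr (κ := κ) (le_succ i))

theorem IsCoalgebraic.exists_restr_eq {a : Lev κ j} (ha : IsCoalgebraic a) (h : j ≤ i) :
    ∃ x, restr h x = a := by
  obtain ⟨X, ζ, x, rfl⟩ := ha
  exact ⟨proj ζ i x, conn_proj ζ h x⟩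

theorem SurjAt.of_surjective (hji : j < i) (h : Function.Surjective (restr (κ := κ) hji.le)) :
    SurjAt κ j := fun x => by
  obtain ⟨y, rfl⟩ := h x
  exact ⟨restr (succ_le_of_lt hji) y, restr_restr _ _ _⟩

/-- A section of the connecting map from level `i + 1` to level `i` is a coalgebra whose `j`-th
projections are the connecting maps. -/
theorem SurjAt.isCoalgebraic (h : SurjAt κ i) (a : Lev κ i) : IsCoalgebraic a := by
  choose s hs using h
  have key : ∀ (j) (hj : j ≤ i) (x : Lev κ i),
      proj (fun x => (finalChainSucc i).symm (s x)) j x = restr hj x := by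
    intro j
    induction j using SuccOrder.prelimitRecOn with
    | succ j _ ih =>
      intro hj x
      rw [proj_succ]
      have hj' : j ≤ i := (le_succ j).trans hj
      rw [PowLT.map_congr (g := restr hj') fun y _ => ih hj' y]
      -- By induction the `j`-th projection is restriction, so the projection of `x` at `j + 1` is
      -- the restriction of `s x`; and `s x` lies over `x`.
      have := conn_finalChainSucc hj' ((finalChainSucc i).symm (s x))
      rw [Equiv.apply_symm_apply] at this
      refine this.symm.trans ?_
      conv_rhs => rw [← hs x, restr_restr]
    | isSuccPrelimit j hj' ih =>
      intro hj x
      refine lev_ext hj' fun k hk => ?_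
      rw [restr_restr, ← ih k hk (hk.le.trans hj)]
      exact conn_proj _ _ _
  exact ⟨_, _, a, (key i le_rfl a).trans (restr_self _ _)⟩

theorem SurjAt.surjective (h : SurjAt κ j) (hji : j ≤ i) :
    Function.Surjective (restr (κ := κ) hji) :=
  fun a => (h.isCoalgebraic a).exists_restr_eq hji

theorem forall_isCoalgebraic_iff :
    (∀ a : Lev κ i, IsCoalgebraic a) ↔ SurjAt κ i :=
  ⟨fun h a => (h a).exists_restr_eq _, fun h => h.isCoalgebraic⟩

theorem surjective_restr_iff (h : j ≤ i) :
    Function.Surjective (restr (κ := κ) h) ↔ j = i ∨ SurjAt κ j := by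
  constructor
  · intro hs
    rcases h.eq_or_lt with e | h'
    · exact Or.inl e
    · exact Or.inr (SurjAt.of_surjective h' hs)
  · rintro (rfl | hs)
    · exact fun x => ⟨x, restr_self _ _⟩
    · exact hs.surjective h

theorem coe_lt_of_lt_aleph0 (hκ : IsRegularOrTop κ) {c : Cardinal.{u}} (hc : c < ℵ₀) :
    (c : WithTop Cardinal) < κ := by
  cases κ with
  | top => exact WithTop.coe_lt_top _
  | coe c' => exact WithTop.coe_lt_coe.2 (hc.trans_le (hκ c' rfl).aleph0_le)

/-- A lift of the singleton `{x}` contains a lift of `x`; conversely, the image of a set under a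
section lifts that set. -/
theorem surjAt_succ_iff (hκ : IsRegularOrTop κ) : SurjAt κ (succ i) ↔ SurjAt κ i := by
  constructor
  · intro h x
    obtain ⟨y, hy⟩ := h (ofSet {x} (coe_lt_of_lt_aleph0 hκ (by simp)))
    have := congrArg members hy
    rw [members_restr_succ (le_succ i), members_ofSet] at this
    obtain ⟨z, -, hz⟩ := this.ge (Set.mem_singleton x)
    exact ⟨z, hz⟩
  · intro h x
    choose s hs using h
    refine ⟨ofSet (s '' members x)
      (lt_of_le_of_lt (WithTop.coe_le_coe.2 mk_image_le) (mk_members_lt x)), ?_⟩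
    apply members_injective
    rw [members_restr_succ (le_succ i), members_ofSet, Set.image_image]
    simp [hs]

theorem surjAt_iff_limitPart (hκ : IsRegularOrTop κ) :
    SurjAt κ i ↔ SurjAt κ (limitPart i) := by
  obtain ⟨-, m, hm⟩ := (limitPart_eq_iff i _).1 rfl
  generalize limitPart i = l at hm
  subst hm
  induction m with
  | zero => simp
  | succ m ih =>
    rw [← ih, ← surjAt_succ_iff hκ (i := l + m)]
    simp [← add_assoc, Order.succ_eq_add_one]

end Coalgebraic

/-! ### Branches through the elements of a point of a limit level -/

section Branches

variable {κ : WithTop Cardinal.{u}} {i j k l : Ordinal.{u}}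

theorem coe_mk_iUnion_lt (hκ : IsRegularOrTop κ) {ι α : Type u} (hι : (#ι : WithTop Cardinal) < κ)
    (s : ι → Set α) (hs : ∀ i, ((#(s i) : Cardinal.{u}) : WithTop Cardinal) < κ) :
    ((#(⋃ i, s i) : Cardinal.{u}) : WithTop Cardinal) < κ := by
  cases κ with
  | top => exact WithTop.coe_lt_top _
  | coe c =>
    rw [WithTop.coe_lt_coe] at hι ⊢
    exact (card_iUnion_lt_iff_forall_of_isRegular (hκ c rfl) hι).2
      fun i => WithTop.coe_lt_coe.1 (hs i)

/-- The set of elements of `a : Lev κ l`, as seen at the level `i < l`. -/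
def slice (hl : IsSuccPrelimit l) (a : Lev κ l) (i : Ordinal.{u}) (hi : i < l) : Set (Lev κ i) :=
  members (restr (hl.succ_lt hi).le a)

theorem restr_image_slice (hl : IsSuccPrelimit l) (a : Lev κ l) (h : j ≤ i) (hi : i < l) :
    restr h '' slice hl a i hi = slice hl a j (h.trans_lt hi) := by
  rw [slice, slice, ← members_restr_succ h (succ_le_succ h), restr_restr]

/-- Successor levels are cofinal below a limit, so `a` is determined by its slices; the candidate
preimage is `S` itself. -/
theorem exists_restr_eq_of_slice (hl : IsSuccPrelimit l) (a : Lev κ l) (S : Set (Lev κ l))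
    (hS : ((#S : Cardinal.{u}) : WithTop Cardinal) < κ)
    (h : ∀ (i) (hi : i < l), restr hi.le '' S = slice hl a i hi) :
    ∃ b, restr (le_succ l) b = a := by
  refine ⟨ofSet S hS, lev_ext_members hl fun j hj => ?_⟩
  have hjl : j < l := (lt_succ j).trans hj
  rw [restr_restr, members_restr_succ hjl.le, members_ofSet]
  exact h j hjl

theorem slice_eq_of_restr_eq (hl : IsSuccPrelimit l) (b : Lev κ (succ l)) (hi : i < l) :
    slice hl (restr (le_succ l) b) i hi = restr hi.le '' members b := by
  rw [slice, restr_restr, members_restr_succ hi.le]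

/-- The tree of branches of `a` through its element `y` at level `j`. -/
def branchTree (hl : IsSuccPrelimit l) (a : Lev κ l) (hj : j < l) (y : Lev κ j) :
    InverseChain.{u, u + 1} (Set.Iio l) where
  -- Taking the witness at `max i j` treats levels below and above `j` alike; at or below `j` the
  -- only possible node is the restriction of `y`.
  level i := {x : Lev κ i.1 // ∃ z ∈ slice hl a (max i.1 j) (max_lt i.2 hj),
    restr (le_max_left _ _) z = x ∧ restr (le_max_right _ _) z = y}
  conn {k i} h x := ⟨restr h x.1, by
    obtain ⟨x, z, hz, rfl, rfl⟩ := x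
    have hm : max k.1 j ≤ max i.1 j := max_le_max_right j h
    refine ⟨restr hm z, ?_, ?_, ?_⟩
    · rw [← restr_image_slice hl a hm (max_lt i.2 hj)]
      exact ⟨z, hz, rfl⟩
    · simp only [restr_restr]
    · simp only [restr_restr]⟩
  conn_self _ _ := Subtype.ext (restr_self _ _)
  conn_conn _ _ _ := Subtype.ext (restr_restr _ _ _)

/-- Slices restrict onto one another, so a witness lifts to higher levels while keeping its
restriction to level `j`. Membership of `y` in the slice provides the root. -/
theorem branchTree_isTidyTree (hl : IsSuccPrelimit l) (a : Lev κ l) (hj : j < l) {y : Lev κ j}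
    (hy : y ∈ slice hl a j hj) : (branchTree hl a hj y).IsTidyTree where
  surjective := by
    rintro k i h ⟨x, z, hz, rfl, rfl⟩
    have hm : max k.1 j ≤ max i.1 j := max_le_max_right j h
    rw [← restr_image_slice hl a hm (max_lt i.2 hj)] at hz
    obtain ⟨w, hw, rfl⟩ := hz
    refine ⟨⟨restr (le_max_left _ _) w, w, hw, rfl, ?_⟩, Subtype.ext ?_⟩
    · simp only [restr_restr]
    · change restr h (restr (le_max_left _ _) w) = restr _ (restr hm w)
      simp only [restr_restr]
  limit_ext i hi x y h := Subtype.ext (lev_ext hi fun j hj =>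
    congrArg Subtype.val (h ⟨j, hj.trans i.2⟩ hj))
  root i _ := by
    rw [← restr_image_slice hl a (le_max_right i.1 j) (max_lt i.2 hj)] at hy
    obtain ⟨w, hw, rfl⟩ := hy
    exact ⟨⟨restr (le_max_left _ _) w, w, hw, rfl, rfl⟩⟩

theorem exists_branch (hl : IsSuccPrelimit l) (a : Lev κ l) (hj : j < l) (y : Lev κ j)
    (h : Nonempty (branchTree hl a hj y).FullBranch) :
    ∃ x : Lev κ l, restr hj.le x = y ∧ ∀ (i) (hi : i < l), restr hi.le x ∈ slice hl a i hi := by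
  obtain ⟨b, hb⟩ := h
  obtain ⟨x, hx⟩ := lev_exists hl (fun i hi => (b ⟨i, hi⟩).1) fun k i hk hi =>
    congrArg Subtype.val (hb ⟨k, hk.trans_lt hi⟩ ⟨i, hi⟩ hk)
  refine ⟨x, ?_, fun i hi => ?_⟩
  · rw [hx j hj]
    obtain ⟨z, -, h1, h2⟩ := (b ⟨j, hj⟩).2
    rw [← h1, ← h2]
  · rw [hx i hi]
    obtain ⟨z, hz, h1, -⟩ := (b ⟨i, hi⟩).2
    rw [← h1, ← restr_image_slice hl a (le_max_left i j) (max_lt hi hj)]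
    exact ⟨z, hz, rfl⟩

/-- Below `κ`, a limit `l` at which all the trees of branches have full branches is one at which
the connecting map is surjective. -/
theorem surjAt_of_fullBranch (hκ : IsRegularOrTop κ) (hl : IsSuccPrelimit l)
    (hlκ : (l.card : WithTop Cardinal) < κ)
    (h : ∀ (a : Lev κ l) (j) (hj : j < l), ∀ y ∈ slice hl a j hj,
      Nonempty (branchTree hl a hj y).FullBranch) : SurjAt κ l := by
  intro a
  have h' := fun j hj y hy => exists_branch hl a hj y (h a j hj y hy)
  choose f hf hf' using h'
  let e : l.ToType ≃o Set.Iio l := Ordinal.ToType.mk.symm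
  -- One chosen branch through each member of each slice: a union of `|l| < κ` sets of size `< κ`,
  -- hence small by regularity.
  let S : Set (Lev κ l) := ⋃ j : l.ToType, Set.range
    fun y : slice hl a (e j).1 (e j).2 => f (e j).1 (e j).2 y.1 y.2
  refine exists_restr_eq_of_slice hl a S ?_ fun i hi => ?_
  · refine coe_mk_iUnion_lt hκ (by rwa [Cardinal.mk_toType]) _ fun j => ?_
    exact lt_of_le_of_lt (WithTop.coe_le_coe.2 mk_range_le) (mk_members_lt _)
  · ext y
    constructor
    · rintro ⟨x, hx, rfl⟩
      obtain ⟨j, ⟨y, rfl⟩⟩ := Set.mem_iUnion.1 hx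
      exact hf' _ _ _ _ _ _
    · intro hy
      obtain ⟨j, hj⟩ := e.surjective ⟨i, hi⟩
      obtain rfl : (e j).1 = i := congrArg Subtype.val hj
      exact ⟨_, Set.mem_iUnion.2 ⟨j, ⟨y, hy⟩, rfl⟩, hf _ _ _ _⟩

end Branches

/-! ### Surjectivity at `0`, at `ω`-cofinal limits and at weakly compact cardinals -/

section Surjectivity

variable {κ : WithTop Cardinal.{u}} {i j k l : Ordinal.{u}}

theorem InverseChain.IsTidyTree.nonempty {D : InverseChain.{u, u + 1} (Set.Iio l)}
    (hD : D.IsTidyTree) (i : Set.Iio l) : Nonempty (D.level i) := by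
  have h0 : (0 : Ordinal) < l := (zero_le).trans_lt i.2
  obtain ⟨r⟩ := hD.root ⟨0, h0⟩ rfl
  obtain ⟨x, -⟩ := hD.surjective ⟨0, h0⟩ i (zero_le (a := i.1)) r
  exact ⟨x⟩

/-- Surjectivity allows nodes to be lifted step by step along a cofinal sequence; all other levels
are filled by restriction. -/
theorem InverseChain.IsTidyTree.nonempty_fullBranch_of_isOmegaCofinal
    {D : InverseChain.{u, u + 1} (Set.Iio l)} (hD : D.IsTidyTree) (hl : IsOmegaCofinal l) :
    Nonempty D.FullBranch := by
  obtain ⟨f, hf, hfl⟩ := hl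
  have hlt : ∀ n, f n < l := fun n => (hf n.lt_succ_self).trans_le (hfl.1 ⟨_, rfl⟩)
  let F : ℕ → Set.Iio l := fun n => ⟨f n, hlt n⟩
  have hF : Monotone F := hf.monotone
  choose g hg using fun n => hD.surjective (F n) (F (n + 1)) (hF n.le_succ)
  let z : ∀ n, D.level (F n) := fun n =>
    Nat.rec (hD.nonempty (F 0)).some (fun n x => g n x) n
  have hz : ∀ n m (h : n ≤ m), D.conn (hF h) (z m) = z n := by
    intro n m h
    induction m, h using Nat.le_induction with
    | base => exact D.conn_self _ _
    | succ m h ih => rw [← ih, ← hg m (z m), D.conn_conn]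
  have hex : ∀ i : Set.Iio l, ∃ n, i ≤ F n := fun i => by
    obtain ⟨_, ⟨n, rfl⟩, hn⟩ := (lt_isLUB_iff hfl).1 i.2
    exact ⟨n, hn.le⟩
  choose n hn using hex
  have key : ∀ (i : Set.Iio l) (a b : ℕ) (ha : i ≤ F a) (hb : i ≤ F b),
      D.conn ha (z a) = D.conn hb (z b) := by
    intro i a b ha hb
    rw [← hz a (max a b) (le_max_left _ _), ← hz b (max a b) (le_max_right _ _),
      D.conn_conn, D.conn_conn]
  refine ⟨⟨fun i => D.conn (hn i) (z (n i)), fun j i h => ?_⟩⟩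
  rw [D.conn_conn]
  exact key _ _ _ _ _

theorem surjAt_zero (hκ : IsRegularOrTop κ) : SurjAt κ 0 := fun a =>
  ⟨ofSet ∅ (coe_lt_of_lt_aleph0 hκ (by simp [aleph0_pos])), Subsingleton.elim _ _⟩

theorem surjAt_of_isOmegaCofinal (hκ : IsRegularOrTop κ) (hl : IsSuccPrelimit l)
    (hlκ : (l.card : WithTop Cardinal) < κ) (h : IsOmegaCofinal l) : SurjAt κ l :=
  surjAt_of_fullBranch hκ hl hlκ fun a _ hj _ hy =>
    (branchTree_isTidyTree hl a hj hy).nonempty_fullBranch_of_isOmegaCofinal h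

/-- Successor levels are bounded by power sets. A point of a limit level is encoded by its graph, a
subset of the disjoint union of the earlier levels, which regularity keeps below `c`. -/
theorem IsWeaklyCompact.mk_lev_lt {c : Cardinal.{u}} (hc : IsWeaklyCompact c) (i : Ordinal.{u})
    (hi : i < c.ord) : #(Lev κ i) < c := by
  induction i using SuccOrder.prelimitRecOn with
  | succ i _ ih =>
    exact (mk_le_of_injective (members_injective (κ := κ) (i := i))).trans_lt
      (hc.powerset_lt _ (ih ((lt_succ i).trans hi)))
  | isSuccPrelimit i hl ih =>
    let e : i.ToType ≃o Set.Iio i := Ordinal.ToType.mk.symm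
    let G : Lev κ i → Set (Σ j : i.ToType, Lev κ (e j).1) :=
      fun x => Set.range fun j => ⟨j, restr (le_of_lt (e j).2) x⟩
    have hG : Function.Injective G := fun x y h => lev_ext hl fun j hj => by
      obtain ⟨j', hj'⟩ := e.surjective ⟨j, hj⟩
      obtain rfl : (e j').1 = j := congrArg Subtype.val hj'
      obtain ⟨k, hk⟩ := h.le ⟨j', rfl⟩
      obtain rfl : k = j' := congrArg Sigma.fst hk
      exact (eq_of_heq (Sigma.mk.inj hk).2).symm
    refine (mk_le_of_injective hG).trans_lt (hc.powerset_lt _ ?_)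
    rw [mk_sigma]
    refine sum_lt_of_isRegular hc.regular ?_ fun j => ih _ (e j).2 (lt_trans (e j).2 hi)
    rw [Cardinal.mk_toType]
    exact lt_ord.1 hi

theorem surjAt_of_isWeaklyCompact (hκ : IsRegularOrTop κ) {c : Cardinal.{u}}
    (hcκ : (c : WithTop Cardinal) < κ) (hc : IsWeaklyCompact c) : SurjAt κ c.ord := by
  refine surjAt_of_fullBranch hκ
    (isSuccLimit_ord hc.regular.aleph0_le).isSuccPrelimit (by simpa using hcκ)
    fun a j hj y hy => hc.tree _ (branchTree_isTidyTree _ a hj hy) fun i => ?_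
  exact (mk_subtype_le _).trans_lt (hc.mk_lev_lt i.1 i.2)

end Surjectivity

/-! ### Stabilization at `κ + ω` -/

section Stabilization

variable {κ : WithTop Cardinal.{u}} {i j k l : Ordinal.{u}} {c : Cardinal.{u}}

/-- Injectivity propagates upwards: direct image along an injective map is injective, which reduces
level `i + 1` to level `j + 1`, and limit levels are separated by their projections. -/
theorem restr_injective (h : Function.Injective (restr (κ := κ) (le_succ j))) (hji : j ≤ i) :
    Function.Injective (restr (κ := κ) hji) := by
  induction i using SuccOrder.prelimitRecOn with
  | succ i _ ih =>
    rcases hji.eq_or_lt with rfl | h'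
    · intro x y hxy
      rwa [restr_self, restr_self] at hxy
    · have h'' : j ≤ i := lt_succ_iff.1 h'
      intro x y hxy
      apply members_injective
      apply (ih h'').image_injective
      rw [← members_restr_succ h'' (succ_le_succ h''), ← members_restr_succ h'' (succ_le_succ h'')]
      congr 1
      apply h
      rwa [restr_restr, restr_restr]
  | isSuccPrelimit i hi ih =>
    intro x y hxy
    rcases hji.eq_or_lt with rfl | h'
    · rwa [restr_self, restr_self] at hxy
    have key : ∀ k (hk : k < i), j ≤ k → restr hk.le x = restr hk.le y := by
      intro k hk hjk
      apply ih k hk hjk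
      rwa [restr_restr, restr_restr]
    refine lev_ext hi fun k hk => ?_
    rcases le_total j k with hjk | hkj
    · exact key k hk hjk
    · have := congrArg (restr hkj) (key j h' le_rfl)
      rwa [restr_restr, restr_restr] at this

/-- If `x` belongs to `b` but not to `b'`, each of the fewer than `c` elements of `b'` differs from
`x` at some level below `c.ord`. By regularity these levels have a bound below `c.ord`, and there no
element of `b'` matches `x`. -/
theorem restr_succ_ord_injective (hc : c.IsRegular) :
    Function.Injective (restr (κ := c) (le_succ c.ord)) := by
  have hl : IsSuccPrelimit c.ord := (isSuccLimit_ord hc.aleph0_le).isSuccPrelimit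
  have key : ∀ b b' : Lev (c : WithTop Cardinal) (succ c.ord),
      restr (le_succ c.ord) b = restr (le_succ c.ord) b' → members b ⊆ members b' := by
    intro b b' h x hx
    by_contra hx'
    have h1 : ∀ y : members b', ∃ j, ∃ hj : j < c.ord, restr hj.le x ≠ restr hj.le y.1 := by
      intro y
      by_contra! hy
      exact hx' (lev_ext hl hy ▸ y.2)
    choose f hf hne using h1
    have hs : ⨆ y, f y < c.ord := by
      refine Ordinal.iSup_lt_of_lt_cof ?_ hf
      rw [hc.cof_ord]
      exact WithTop.coe_lt_coe.1 (mk_members_lt b')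
    have hmem : restr hs.le x ∈ slice hl (restr (le_succ c.ord) b') _ hs := by
      rw [← h, slice_eq_of_restr_eq]
      exact ⟨x, hx, rfl⟩
    rw [slice_eq_of_restr_eq] at hmem
    obtain ⟨y, hy, hyx⟩ := hmem
    have hle : f ⟨y, hy⟩ ≤ ⨆ y, f y := Ordinal.le_iSup f ⟨y, hy⟩
    apply hne ⟨y, hy⟩
    have := congrArg (restr hle) hyx
    rw [restr_restr, restr_restr] at this
    exact this.symm
  exact fun b b' h => members_injective (Set.Subset.antisymm (key b b' h) (key b' b h.symm))

theorem isOmegaCofinal_add_omega0 (i : Ordinal.{u}) : IsOmegaCofinal (i + Ordinal.omega0) := by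
  refine ⟨fun n => i + n, fun a b h => by simpa using h, ?_, ?_⟩
  · rintro _ ⟨n, rfl⟩
    exact add_le_add_right (Ordinal.natCast_lt_omega0 n).le i
  · intro b hb
    refine (Ordinal.isNormal_add_right i).le_iff_forall_le Ordinal.isSuccLimit_omega0 |>.2 ?_
    intro a ha
    obtain ⟨n, rfl⟩ := Ordinal.lt_omega0.1 ha
    exact hb ⟨n, rfl⟩

theorem isSuccPrelimit_add_omega0 (i : Ordinal.{u}) : IsSuccPrelimit (i + Ordinal.omega0) :=
  (Ordinal.isSuccLimit_add i Ordinal.isSuccLimit_omega0).isSuccPrelimit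

/-- There are too many levels to choose a branch for every node, but above `c.ord` a branch is
determined by its restriction to level `c.ord`. One branch for each of the fewer than `c` members of
that slice covers everything. -/
theorem surjAt_ord_add_omega0 (hc : c.IsRegular) :
    SurjAt (c : WithTop Cardinal) (c.ord + Ordinal.omega0) := by
  intro a
  have hl := isSuccPrelimit_add_omega0 c.ord
  have hcl : c.ord < c.ord + Ordinal.omega0 := lt_add_of_pos_right _ Ordinal.omega0_pos
  have hinj : ∀ {i} (h : c.ord ≤ i), Function.Injective (restr (κ := c) h) :=
    fun h => restr_injective (restr_succ_ord_injective hc) h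
  have h' := fun y hy => exists_branch hl a hcl y
    ((branchTree_isTidyTree hl a hcl hy).nonempty_fullBranch_of_isOmegaCofinal
      (isOmegaCofinal_add_omega0 _))
  choose f hf hf' using h'
  refine exists_restr_eq_of_slice hl a (Set.range fun y : slice hl a _ hcl => f y.1 y.2)
    (lt_of_le_of_lt (WithTop.coe_le_coe.2 mk_range_le) (mk_members_lt _)) fun i hi => ?_
  ext x
  constructor
  · rintro ⟨_, ⟨y, rfl⟩, rfl⟩
    exact hf' _ _ _ _
  · intro hx
    rcases le_total c.ord i with h | h
    · have hy : restr h x ∈ slice hl a _ hcl := by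
        rw [← restr_image_slice hl a h hi]
        exact ⟨x, hx, rfl⟩
      refine ⟨_, ⟨⟨_, hy⟩, rfl⟩, hinj h ?_⟩
      rw [restr_restr]
      exact hf _ _
    · rw [← restr_image_slice hl a h hcl] at hx
      obtain ⟨y, hy, rfl⟩ := hx
      refine ⟨_, ⟨⟨y, hy⟩, rfl⟩, ?_⟩
      rw [← restr_restr h hcl.le, hf]

/-- A lift of the restriction of `a` to level `c.ord + ω` agrees with `a` at level `c.ord`, hence by
injectivity at level `l`. -/
theorem surjAt_of_ord_add_omega0_le (hc : c.IsRegular) (h : c.ord + Ordinal.omega0 ≤ l) :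
    SurjAt (c : WithTop Cardinal) l := by
  intro a
  obtain ⟨b, hb⟩ := (surjAt_ord_add_omega0 hc).surjective (h.trans (le_succ l)) (restr h a)
  have hcl : c.ord ≤ c.ord + Ordinal.omega0 := le_self_add
  refine ⟨b, restr_injective (restr_succ_ord_injective hc) (hcl.trans h) ?_⟩
  have := congrArg (restr hcl) hb
  rw [restr_restr, restr_restr] at this
  rw [restr_restr, ← this]

end Stabilization

/-! ### Threads through the whole final chain -/

section Threads

variable {κ : WithTop Cardinal.{u}} {i j k l a b : Ordinal.{u}}

/-- A thread is a full branch through the whole final chain. -/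
abbrev Thread (κ : WithTop Cardinal.{u}) : Type (u + 1) := (finalChain κ).FullBranch

theorem Thread.restr_eq (τ : Thread κ) (h : j ≤ i) : restr h (τ.1 i) = τ.1 j := τ.2 j i h

theorem Thread.eq_of_le {σ τ : Thread κ} (h : j ≤ i) (e : σ.1 i = τ.1 i) : σ.1 j = τ.1 j := by
  rw [← σ.restr_eq h, ← τ.restr_eq h, e]

/-- A set of threads that occupies fewer than `κ` elements of each level. -/
def Thin (S : Set (Thread κ)) : Prop :=
  ∀ i, ((#((fun τ : Thread κ => τ.1 i) '' S) : Cardinal.{u}) : WithTop Cardinal) < κ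

theorem thin_of_subset_range {J : Type u} (hJ : (#J : WithTop Cardinal) < κ) {f : J → Thread κ}
    {S : Set (Thread κ)} (hS : S ⊆ Set.range f) : Thin S := fun i => by
  refine lt_of_le_of_lt (WithTop.coe_le_coe.2 ?_) hJ
  have : (fun τ : Thread κ => τ.1 i) '' S ⊆ Set.range fun x => (f x).1 i := by
    rintro _ ⟨τ, hτ, rfl⟩
    obtain ⟨x, rfl⟩ := hS hτ
    exact ⟨x, rfl⟩
  exact (mk_le_mk_of_subset this).trans mk_range_le

theorem thin_empty (hκ : IsRegularOrTop κ) : Thin (∅ : Set (Thread κ)) := fun i => by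
  simpa using coe_lt_of_lt_aleph0 hκ (c := 0) aleph0_pos

open scoped Classical in
/-- The part of a set of threads used by `setThread`: everything if the set is thin. -/
def thinPart (S : Set (Thread κ)) : Set (Thread κ) := if Thin S then S else ∅

theorem thin_thinPart (hκ : IsRegularOrTop κ) (S : Set (Thread κ)) : Thin (thinPart S) := by
  unfold thinPart
  split_ifs with h
  exacts [h, thin_empty hκ]

/-- The thread with a given thin set of threads as elements. -/
def setThread (hκ : IsRegularOrTop κ) (S : Set (Thread κ)) : Thread κ :=
  -- Reading the value at `i` off level `i + 1` avoids a case distinction between successors and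
  -- limits.
  ⟨fun i => restr (le_succ i)
    (ofSet ((fun τ : Thread κ => τ.1 i) '' thinPart S) (thin_thinPart hκ S i)), fun j i h => by
    change restr h (restr _ _) = _
    rw [restr_restr, ← restr_restr (le_succ j) (succ_le_succ h)]
    congr 1
    apply members_injective
    rw [members_restr_succ h, members_ofSet, members_ofSet, Set.image_image]
    exact Set.image_congr fun τ _ => τ.restr_eq h⟩

theorem members_setThread (hκ : IsRegularOrTop κ) {S : Set (Thread κ)} (hS : Thin S)
    (i : Ordinal.{u}) :
    members ((setThread hκ S).1 (succ i)) = (fun τ : Thread κ => τ.1 i) '' S := by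
  change members (restr _ _) = _
  rw [members_restr_succ (le_succ i), members_ofSet, thinPart, if_pos hS, Set.image_image]
  exact Set.image_congr fun τ _ => τ.restr_eq _

/-- The thread of the von Neumann ordinal `i`. -/
def ordThread (hκ : IsRegularOrTop κ) (i : Ordinal.{u}) : Thread κ :=
  -- The default `∅` for sets that are not thin lets the recursion run over all ordinals; only those
  -- of cardinality `< κ` are used later.
  setThread hκ (Set.range fun k : Set.Iio i => ordThread hκ k.1)
termination_by i
decreasing_by exact k.2

/-- The thread of a set of von Neumann ordinals. -/
def subThread (hκ : IsRegularOrTop κ) (B : Set Ordinal.{u}) : Thread κ :=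
  setThread hκ (ordThread hκ '' B)

theorem ordThread_eq (hκ : IsRegularOrTop κ) (i : Ordinal.{u}) :
    ordThread hκ i = subThread hκ (Set.Iio i) := by
  rw [ordThread, subThread, Set.image_eq_range]

theorem members_subThread (hκ : IsRegularOrTop κ) {B : Set Ordinal.{u}} (hB : B ⊆ Set.Iio l)
    (hl : (l.card : WithTop Cardinal) < κ) (i : Ordinal.{u}) :
    members ((subThread hκ B).1 (succ i)) = (fun m => (ordThread hκ m).1 i) '' B := by
  rw [subThread, members_setThread, Set.image_image]
  have hJ : (#l.ToType : WithTop Cardinal) < κ := by rwa [Cardinal.mk_toType]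
  refine thin_of_subset_range hJ
    (f := fun x => ordThread hκ (Ordinal.ToType.mk.symm x : Set.Iio l).1) ?_
  rintro _ ⟨m, hm, rfl⟩
  exact ⟨Ordinal.ToType.mk ⟨m, hB hm⟩, by simp⟩

theorem card_lt_of_le (h : i ≤ j) (hj : (j.card : WithTop Cardinal) < κ) :
    (i.card : WithTop Cardinal) < κ :=
  lt_of_le_of_lt (WithTop.coe_le_coe.2 (Ordinal.card_le_card h)) hj

theorem members_ordThread (hκ : IsRegularOrTop κ) (ha : (a.card : WithTop Cardinal) < κ)
    (i : Ordinal.{u}) :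
    members ((ordThread hκ a).1 (succ i)) = (fun m => (ordThread hκ m).1 i) '' Set.Iio a := by
  rw [ordThread_eq, members_subThread hκ subset_rfl ha]

/-- At level `j + 1` the elements are seen at level `j`, where by induction all those `≥ j` collapse
to `j`. -/
theorem ordThread_eq_of_le (hκ : IsRegularOrTop κ) (j : Ordinal.{u}) :
    ∀ a, j ≤ a → (a.card : WithTop Cardinal) < κ → (ordThread hκ a).1 j = (ordThread hκ j).1 j := by
  induction j using SuccOrder.prelimitRecOn with
  | succ j _ ih =>
    intro a hja ha
    apply members_injective
    rw [members_ordThread hκ ha, members_ordThread hκ (card_lt_of_le hja ha)]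
    refine Set.Subset.antisymm ?_ (Set.image_mono (Set.Iio_subset_Iio hja))
    rintro _ ⟨m, hm, rfl⟩
    rcases le_or_gt j m with h | h
    · exact ⟨j, lt_succ j, (ih m h (card_lt_of_le (le_of_lt hm) ha)).symm⟩
    · exact ⟨m, h.trans (lt_succ j), rfl⟩
  | isSuccPrelimit j hj ih =>
    intro a hja ha
    refine lev_ext hj fun k hk => ?_
    rw [Thread.restr_eq, Thread.restr_eq, ih k hk a (hk.le.trans hja) ha,
      ih k hk j hk.le (card_lt_of_le hja ha)]

/-- Since `a` is an element of `b`, agreement at level `a + 1` would make some `m < a` agree with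
`a` at level `a`, against the induction hypothesis. -/
theorem ordThread_ne (hκ : IsRegularOrTop κ) (hb : (b.card : WithTop Cardinal) < κ)
    (hab : a < b) (haj : a < j) : (ordThread hκ a).1 j ≠ (ordThread hκ b).1 j := by
  induction a using WellFoundedLT.induction generalizing b j with
  | ind a ih =>
    intro h
    have ha := card_lt_of_le hab.le hb
    have h' := congrArg members (Thread.eq_of_le (succ_le_of_lt haj) h)
    rw [members_ordThread hκ ha, members_ordThread hκ hb] at h'
    obtain ⟨m, hm, hma⟩ := h'.ge ⟨a, hab, rfl⟩
    exact ih m hm ha hm hm hma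

theorem ordThread_inj (hκ : IsRegularOrTop κ) (ha : (a.card : WithTop Cardinal) < κ)
    (hb : (b.card : WithTop Cardinal) < κ) (haj : a < j)
    (h : (ordThread hκ a).1 j = (ordThread hκ b).1 j) : a = b := by
  rcases lt_trichotomy a b with hab | hab | hab
  · exact absurd h (ordThread_ne hκ hb hab haj)
  · exact hab
  · exact absurd h.symm (ordThread_ne hκ ha hab (hab.trans haj))

/-- A set of ordinals `≤ s` can be recovered from level `s + 2` of its thread. -/
theorem subThread_inj (hκ : IsRegularOrTop κ) (hl : (l.card : WithTop Cardinal) < κ)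
    {C C' : Set Ordinal.{u}} (hC : C ⊆ Set.Iio l) (hC' : C' ⊆ Set.Iio l) {s : Ordinal.{u}}
    (hs : C ⊆ Set.Iic s)
    (h : (subThread hκ C).1 (succ (succ s)) = (subThread hκ C').1 (succ (succ s))) : C = C' := by
  have h' := congrArg members h
  rw [members_subThread hκ hC hl, members_subThread hκ hC' hl] at h'
  -- Only one of the two ordinals has to lie below the level that separates them, so no bound on
  -- `C'` by `s` is needed.
  have inj : ∀ m ∈ C, ∀ m' ∈ C', (ordThread hκ m).1 (succ s) = (ordThread hκ m').1 (succ s) →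
      m = m' := fun m hm m' hm' e =>
    ordThread_inj hκ (card_lt_of_le (le_of_lt (hC hm)) hl) (card_lt_of_le (le_of_lt (hC' hm')) hl)
      (lt_succ_of_le (hs hm)) e
  ext m
  constructor
  · intro hm
    obtain ⟨m', hm', e⟩ := h'.le ⟨m, hm, rfl⟩
    rwa [inj m hm m' hm' e.symm]
  · intro hm
    obtain ⟨m', hm', e⟩ := h'.ge ⟨m, hm, rfl⟩
    rwa [← inj m' hm' m hm e]

/-- At level `j`, ordinals `≥ j` look the same. -/
theorem subThread_insert_congr (hκ : IsRegularOrTop κ) (hl : (l.card : WithTop Cardinal) < κ)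
    {B : Set Ordinal.{u}} (hB : B ⊆ Set.Iio l) (ha : a < l) (hb : b < l)
    (hja : j ≤ a) (hjb : j ≤ b) :
    (subThread hκ (insert a B)).1 j = (subThread hκ (insert b B)).1 j := by
  apply Thread.eq_of_le (le_succ j)
  apply members_injective
  rw [members_subThread hκ (Set.insert_subset ha hB) hl,
    members_subThread hκ (Set.insert_subset hb hB) hl, Set.image_insert_eq, Set.image_insert_eq,
    ordThread_eq_of_le hκ j a hja (card_lt_of_le ha.le hl),
    ordThread_eq_of_le hκ j b hjb (card_lt_of_le hb.le hl)]

/-! ### Failure of surjectivity at `κ` -/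

/-- The point looks at each level `j < c.ord` like the ordinal `j`, that is, like the set of all
ordinals below `c.ord`. A preimage would need for each `m < c.ord` an element that looks like `m` at
level `m + 1`, and these are pairwise distinct. -/
theorem not_surjAt_ord {c : Cardinal.{u}} (hκ : IsRegularOrTop (c : WithTop Cardinal)) :
    ¬ SurjAt (c : WithTop Cardinal) c.ord := by
  intro hs
  have hc : c.IsRegular := hκ c rfl
  have hl : IsSuccPrelimit c.ord := (isSuccLimit_ord hc.aleph0_le).isSuccPrelimit
  have hcard : ∀ {i : Ordinal.{u}}, i < c.ord → (i.card : WithTop Cardinal) < c :=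
    fun h => WithTop.coe_lt_coe.2 (lt_ord.1 h)
  obtain ⟨a, ha⟩ := lev_exists (κ := c) hl (fun j _ => (ordThread hκ j).1 j) fun j k hj hk => by
    rw [Thread.restr_eq, ordThread_eq_of_le hκ j k hj (hcard hk)]
  obtain ⟨b, rfl⟩ := hs a
  have hex : ∀ m : c.ord.ToType, ∃ x ∈ members b, ∀ h : succ (Ordinal.ToType.mk.symm m).1 ≤ c.ord,
      restr h x = (ordThread hκ (Ordinal.ToType.mk.symm m).1).1
        (succ (Ordinal.ToType.mk.symm m).1) := by
    intro m
    generalize Ordinal.ToType.mk.symm m = m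
    obtain ⟨m, hm⟩ := m
    have hm1 : succ m < c.ord := hl.succ_lt hm
    have hm2 : succ (succ m) < c.ord := hl.succ_lt hm1
    -- At level `m + 2` the point is the ordinal `m + 2`, one of whose elements is `m`, seen at
    -- level `m + 1`.
    have h1 : members (restr hm2.le (restr (le_succ c.ord) b))
        = members ((ordThread hκ (succ (succ m))).1 (succ (succ m))) := by rw [ha _ hm2]
    rw [restr_restr, members_restr_succ hm1.le, members_ordThread hκ (hcard hm2)] at h1
    obtain ⟨x, hx, hxm⟩ := h1.ge ⟨m, (lt_succ m).trans (lt_succ _), rfl⟩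
    exact ⟨x, hx, fun _ => hxm⟩
  choose f hf hf' using hex
  have hinj : Function.Injective fun m => (⟨f m, hf m⟩ : members b) := by
    intro m n hmn
    have hmn' : f m = f n := congrArg Subtype.val hmn
    have h1 := hf' m
    have h2 := hf' n
    rw [hmn'] at h1
    apply Ordinal.ToType.mk.symm.injective
    generalize Ordinal.ToType.mk.symm m = m at *
    generalize Ordinal.ToType.mk.symm n = n at *
    obtain ⟨m, hm⟩ := m
    obtain ⟨n, hn⟩ := n
    rw [Set.mem_Iio] at hm hn
    refine Subtype.ext ?_
    change m = n
    have key : ∀ {m n : Ordinal.{u}} (x : Lev (c : WithTop Cardinal) c.ord) (hm : m < c.ord)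
        (hn : n < c.ord), m ≤ n → (∀ h, restr (i := c.ord) h x = (ordThread hκ m).1 (succ m)) →
        (∀ h, restr (i := c.ord) h x = (ordThread hκ n).1 (succ n)) → m = n := by
      intro m n x hm hn hle h1 h2
      refine ordThread_inj hκ (hcard hm) (hcard hn) (lt_succ m) ?_
      rw [← h1 (succ_le_of_lt hm), ← Thread.restr_eq _ (succ_le_succ hle),
        ← h2 (succ_le_of_lt hn), restr_restr]
    rcases le_total m n with h | h
    · exact key _ hm hn h h1 h2
    · exact (key _ hn hm h h2 h1).symm
  have := (mk_le_of_injective hinj).trans_lt (WithTop.coe_lt_coe.1 (mk_members_lt b))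
  simp at this

end Threads

/-! ### Encoding trees into the final chain -/

/-- A code of the tree `D` below `l`: the nodes at level `i` are labelled injectively by sets of
ordinals `< c i`, where `c` maps the height of the tree cofinally into `l`. -/
structure TreeCode {I : Type v} [LinearOrder I] (D : InverseChain.{u, v} I) (l : Ordinal.{u})
    (L : Type u) where
  c : I → Ordinal.{u}
  strictMono : StrictMono c
  lt : ∀ i, c i < l
  cofinal : ∀ j < l, ∃ i, j ≤ c i
  label : L → Set Ordinal.{u}
  label_subset : ∀ x, label x ⊆ Set.Iio l
  code : ∀ i, D.level i → L
  code_subset : ∀ i d, label (code i d) ⊆ Set.Iio (c i)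
  code_injective : ∀ i d d', label (code i d) = label (code i d') → d = d'

namespace TreeCode

variable {κ : WithTop Cardinal.{u}} {I : Type v} [LinearOrder I] {D : InverseChain.{u, v} I}
  {l : Ordinal.{u}} {L : Type u} (T : TreeCode D l L)

/-- The set of ordinals that describes the ancestor of `d` at level `k`. -/
def entry {i : I} (d : D.level i) (k : Set.Iic i) : Set Ordinal.{u} :=
  insert (T.c k.1) (T.label (T.code k.1 (D.conn k.2 d)))

/-- The elements of the thread of `d`: the descriptions of the ancestors of `d`, and all labels
marked with the ordinal `l`. -/
def entries (hκ : IsRegularOrTop κ) {i : I} (d : D.level i) : Set (Thread κ) :=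
  (Set.range fun k : Set.Iic i => subThread hκ (T.entry d k)) ∪
    Set.range fun x : L => subThread hκ (insert l (T.label x))

/-- The thread of a node of the tree. -/
def node (hκ : IsRegularOrTop κ) {i : I} (d : D.level i) : Thread κ :=
  setThread hκ (T.entries hκ d)

theorem thin_entries (hκ : IsRegularOrTop κ) (hlκ : (l.card : WithTop Cardinal) < κ)
    (hL : (#L : WithTop Cardinal) < κ) (hκ₀ : (ℵ₀ : WithTop Cardinal) < κ)
    {i : I} (d : D.level i) : Thin (T.entries hκ d) := by
  have hi : Nonempty (Set.Iic i) := ⟨⟨i, le_rfl⟩⟩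
  -- The index type may live in another universe; `T.c` embeds its initial segments into `l`.
  let g : Set.Iic i → l.ToType := fun k => Ordinal.ToType.mk ⟨T.c k.1, T.lt k.1⟩
  have hinj : Function.Injective g := fun k k' h =>
    Subtype.ext (T.strictMono.injective (congrArg Subtype.val (Ordinal.ToType.mk.injective h)))
  have hJ : (#(l.ToType ⊕ L) : WithTop Cardinal) < κ := by
    rw [mk_sum, lift_id, lift_id, Cardinal.mk_toType]
    cases κ with
    | top => exact WithTop.coe_lt_top _
    | coe c =>
      rw [WithTop.coe_lt_coe] at *
      exact add_lt_of_lt hκ₀.le hlκ hL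
  refine thin_of_subset_range hJ (f := Sum.elim
    (fun x => subThread hκ (T.entry d (Function.invFun g x)))
    fun x => subThread hκ (insert l (T.label x))) ?_
  rintro _ (⟨k, rfl⟩ | ⟨x, rfl⟩)
  · exact ⟨Sum.inl _, congrArg (fun k => subThread hκ (T.entry d k))
      (Function.leftInverse_invFun hinj k)⟩
  · exact ⟨Sum.inr x, rfl⟩

theorem entry_conn {i i' : I} (h : i' ≤ i) (d : D.level i) (k : Set.Iic i') :
    T.entry (D.conn h d) k = T.entry d ⟨k.1, k.2.trans h⟩ := by
  exact congrArg (fun x => insert (T.c k.1) (T.label (T.code k.1 x))) (D.conn_conn k.2 h d)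

theorem entry_subset {i : I} (d : D.level i) (k : Set.Iic i) :
    T.entry d k ⊆ Set.Iic (T.c k.1) :=
  Set.insert_subset (Set.mem_Iic.2 le_rfl) ((T.code_subset _ _).trans Set.Iio_subset_Iic_self)

/-- Up to level `T.c i'`, the marker `T.c k` of an entry with `k ≥ i'` cannot be told from `l`. The
additional entries of `d` are thus absorbed by the copies marked with `l`, which every node
contains. -/
theorem node_eq_node_conn (hκ : IsRegularOrTop κ) (hlκ : ((succ l).card : WithTop Cardinal) < κ)
    (hL : (#L : WithTop Cardinal) < κ) (hκ₀ : (ℵ₀ : WithTop Cardinal) < κ) {i i' : I} (h : i' ≤ i)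
    (d : D.level i) {j : Ordinal.{u}} (hj : j ≤ T.c i') :
    (T.node hκ d).1 j = (T.node hκ (D.conn h d)).1 j := by
  have hlκ' := card_lt_of_le (le_succ l) hlκ
  have hcongr : ∀ (k : I) (x : L), i' ≤ k → (subThread hκ (insert (T.c k) (T.label x))).1 j
      = (subThread hκ (insert l (T.label x))).1 j := fun k x hk =>
    subThread_insert_congr hκ hlκ ((T.label_subset x).trans (Set.Iio_subset_Iio (le_succ l)))
      ((T.lt k).trans (lt_succ l)) (lt_succ l) (hj.trans (T.strictMono.monotone hk))
      (hj.trans (T.lt i').le)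
  apply Thread.eq_of_le (le_succ j)
  apply members_injective
  rw [node, node, members_setThread hκ (T.thin_entries hκ hlκ' hL hκ₀ _),
    members_setThread hκ (T.thin_entries hκ hlκ' hL hκ₀ _)]
  apply Set.Subset.antisymm
  · rintro _ ⟨_, ⟨⟨k, hk⟩, rfl⟩ | ⟨x, rfl⟩, rfl⟩
    · rcases le_or_gt k i' with hk' | hk'
      · refine ⟨_, Or.inl ⟨⟨k, hk'⟩, rfl⟩, ?_⟩
        simp only [entry_conn]
      · exact ⟨_, Or.inr ⟨T.code k (D.conn hk d), rfl⟩, (hcongr k _ hk'.le).symm⟩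
    · exact ⟨_, Or.inr ⟨x, rfl⟩, rfl⟩
  · rintro _ ⟨_, ⟨⟨k, hk⟩, rfl⟩ | ⟨x, rfl⟩, rfl⟩
    · refine ⟨_, Or.inl ⟨⟨k, le_trans hk h⟩, rfl⟩, ?_⟩
      simp only [entry_conn]
    · exact ⟨_, Or.inr ⟨x, rfl⟩, rfl⟩

/-- Elements of the nodes are compared at level `T.c k + 2`, where sets of ordinals `≤ T.c k` can be
recovered. The entry of `d` at `k` has greatest element `T.c k < l`, so it matches no copy marked
with `l`, only the entry of `d'` at `k`. Removing the greatest element leaves the label, which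
determines the ancestor. -/
theorem conn_eq_of_node_eq (hκ : IsRegularOrTop κ) (hlκ : ((succ l).card : WithTop Cardinal) < κ)
    (hL : (#L : WithTop Cardinal) < κ) (hκ₀ : (ℵ₀ : WithTop Cardinal) < κ) {i i' k : I}
    (h : k ≤ i) (h' : k ≤ i') (d : D.level i) (d' : D.level i')
    (e : (T.node hκ d).1 (succ (succ (succ (T.c k))))
      = (T.node hκ d').1 (succ (succ (succ (T.c k))))) :
    D.conn h d = D.conn h' d' := by
  have hlκ' := card_lt_of_le (le_succ l) hlκ
  have e' := congrArg members e
  rw [node, node, members_setThread hκ (T.thin_entries hκ hlκ' hL hκ₀ _),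
    members_setThread hκ (T.thin_entries hκ hlκ' hL hκ₀ _)] at e'
  have hentry : ∀ {i : I} (d : D.level i) (k : Set.Iic i), T.entry d k ⊆ Set.Iio (succ l) :=
    fun d k => (T.entry_subset d k).trans fun x hx => (hx.trans_lt (T.lt _)).trans (lt_succ l)
  obtain ⟨_, ⟨⟨k', hk'⟩, rfl⟩ | ⟨x, rfl⟩, hτ⟩ := e'.le ⟨_, Or.inl ⟨⟨k, h⟩, rfl⟩, rfl⟩
  · have he := subThread_inj hκ hlκ (hentry _ _) (hentry _ _) (T.entry_subset d ⟨k, h⟩) hτ.symm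
    have hle : T.c k' ≤ T.c k := T.entry_subset d ⟨k, h⟩ (he.ge (Set.mem_insert _ _))
    have hge : T.c k ≤ T.c k' := T.entry_subset d' ⟨k', hk'⟩ (he.le (Set.mem_insert _ _))
    obtain rfl : k' = k := T.strictMono.injective (hle.antisymm hge)
    apply T.code_injective
    have hnot : ∀ {i : I} (d : D.level i), T.c i ∉ T.label (T.code i d) := fun d hd =>
      lt_irrefl (T.c _) (T.code_subset _ d hd)
    have := congrArg (fun s => s \ {T.c k'}) he
    simpa [entry, Set.insert_sdiff_of_mem, Set.sdiff_singleton_eq_self, hnot] using this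
  · have hx : insert l (T.label x) ⊆ Set.Iio (succ l) :=
      Set.insert_subset (lt_succ l) ((T.label_subset x).trans (Set.Iio_subset_Iio (le_succ l)))
    have he := subThread_inj hκ hlκ (hentry _ _) hx (T.entry_subset d ⟨k, h⟩) hτ.symm
    have hle : l ≤ T.c k := T.entry_subset d ⟨k, h⟩ (he.ge (Set.mem_insert _ _))
    exact absurd hle (T.lt k).not_ge

/-- A tree without full branches obstructs surjectivity. -/
theorem not_surjAt (T : TreeCode D l L) (hκ : IsRegularOrTop κ) (hl : IsSuccPrelimit l)
    (hlκ : ((succ l).card : WithTop Cardinal) < κ)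
    (hL : (#L : WithTop Cardinal) < κ) (hκ₀ : (ℵ₀ : WithTop Cardinal) < κ)
    (hsurj : ∀ (j i : I) (h : j ≤ i), Function.Surjective (D.conn h))
    (hne : ∀ i, Nonempty (D.level i))
    (hD : ∀ i, ((#(D.level i) : Cardinal.{u}) : WithTop Cardinal) < κ)
    (hbr : IsEmpty D.FullBranch) : ¬ SurjAt κ l := by
  intro hs
  let A : ∀ j, Set (Lev κ j) := fun j =>
    {y | ∃ i, j ≤ T.c i ∧ ∃ d : D.level i, (T.node hκ d).1 j = y}
  -- A single sufficiently high level of the tree already gives all of `A j`, which makes it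
  -- `<κ`-sized and compatible with restriction.
  have hA : ∀ (j) (i), j ≤ T.c i → A j = Set.range fun d : D.level i => (T.node hκ d).1 j := by
    intro j i hij
    refine Set.Subset.antisymm ?_ ?_
    · rintro _ ⟨i', hij', d, rfl⟩
      rcases le_total i i' with h | h
      · exact ⟨D.conn h d, (T.node_eq_node_conn hκ hlκ hL hκ₀ h d hij).symm⟩
      · obtain ⟨d, rfl⟩ := hsurj _ _ h d
        exact ⟨d, T.node_eq_node_conn hκ hlκ hL hκ₀ h d hij'⟩
    · rintro _ ⟨d, rfl⟩
      exact ⟨i, hij, d, rfl⟩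
  have hAκ : ∀ j < l, ((#(A j) : Cardinal.{u}) : WithTop Cardinal) < κ := by
    intro j hj
    obtain ⟨i, hi⟩ := T.cofinal j hj
    rw [hA j i hi]
    exact lt_of_le_of_lt (WithTop.coe_le_coe.2 mk_range_le) (hD i)
  have himage : ∀ (j k) (h : j ≤ k), k < l → restr h '' A k = A j := by
    intro j k h hk
    obtain ⟨i, hi⟩ := T.cofinal k hk
    rw [hA k i hi, hA j i (h.trans hi), ← Set.range_comp]
    exact congrArg Set.range (funext fun d => Thread.restr_eq _ _)
  -- The point whose slices are the sets `A j`.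
  obtain ⟨a, ha⟩ := lev_exists (κ := κ) hl (fun j hj => restr (le_succ j) (ofSet (A j) (hAκ j hj)))
    fun j k hj hk => by
      rw [restr_restr, ← restr_restr (le_succ j) (succ_le_succ hj)]
      congr 1
      apply members_injective
      rw [members_restr_succ hj, members_ofSet, members_ofSet, himage j k hj hk]
  obtain ⟨b, hb⟩ := hs a
  have hslice : ∀ (j) (hj : j < l), restr hj.le '' members b = A j := by
    intro j hj
    rw [← slice_eq_of_restr_eq hl b hj, hb, slice, ha _ (hl.succ_lt hj), members_restr_succ (le_succ j),
      members_ofSet, himage _ _ _ (hl.succ_lt hj)]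
  have hI : Nonempty I := by
    by_contra! hI
    exact hbr.false ⟨fun i => isEmptyElim i, fun i => isEmptyElim i⟩
  obtain ⟨i₀⟩ := hI
  obtain ⟨d₀⟩ := hne i₀
  have hd₀ : (T.node hκ d₀).1 (T.c i₀) ∈ A (T.c i₀) := ⟨i₀, le_rfl, d₀, rfl⟩
  rw [← hslice _ (T.lt i₀)] at hd₀
  obtain ⟨x, hx, -⟩ := hd₀
  have hlt : ∀ k, succ (succ (succ (T.c k))) < l := fun k =>
    hl.succ_lt (hl.succ_lt (hl.succ_lt (T.lt k)))
  -- At level `T.c k + 3` the fixed element `x` looks like a node of height at least `k`, which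
  -- determines an ancestor at `k`; as `k` varies, these ancestors form a full branch.
  have hex : ∀ k, ∃ i, ∃ _ : k ≤ i, ∃ d : D.level i,
      (T.node hκ d).1 (succ (succ (succ (T.c k)))) = restr (hlt k).le x := by
    intro k
    obtain ⟨i, hi, d, hd⟩ := (hslice _ (hlt k)).le ⟨x, hx, rfl⟩
    refine ⟨i, ?_, d, hd⟩
    rw [← T.strictMono.le_iff_le]
    exact (((le_succ _).trans (le_succ _)).trans (le_succ _)).trans hi
  choose f hf d hd using hex
  refine hbr.false ⟨fun k => D.conn (hf k) (d k), fun k' k h => ?_⟩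
  rw [D.conn_conn]
  refine T.conn_eq_of_node_eq hκ hlκ hL hκ₀ _ _ _ _ ?_
  have hc : succ (succ (succ (T.c k'))) ≤ succ (succ (succ (T.c k))) :=
    succ_le_succ (succ_le_succ (succ_le_succ (T.strictMono.monotone h)))
  rw [hd k', ← Thread.restr_eq _ hc, hd k, restr_restr]

end TreeCode

/-! ### A tree of finite sets without full branches -/

section FiniteSets

variable (I : Type u) [LinearOrder I]

/-- The tree whose nodes at `i` are the finite sets with exactly one element `≥ i`; to restrict
a node to `j`, discard the elements beyond the first one `≥ j`. -/
def finsetTree : InverseChain.{u, u} I where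
  level i := {s : Finset I // (∃ x ∈ s, i ≤ x) ∧ ∀ x ∈ s, ∀ y ∈ s, y < x → y < i}
  conn {j i} h s := ⟨s.1.filter fun x => ∀ y ∈ s.1, y < x → y < j, by
    obtain ⟨s, ⟨x, hx, hix⟩, hs⟩ := s
    refine ⟨?_, fun x hx y hy hyx => (Finset.mem_filter.1 hx).2 y (Finset.mem_filter.1 hy).1 hyx⟩
    have hne : (s.filter (j ≤ ·)).Nonempty := ⟨x, Finset.mem_filter.2 ⟨hx, h.trans hix⟩⟩
    have hmin := Finset.mem_filter.1 (Finset.min'_mem _ hne)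
    refine ⟨(s.filter (j ≤ ·)).min' hne, Finset.mem_filter.2 ⟨hmin.1, fun y hy hlt => ?_⟩, hmin.2⟩
    by_contra hjy
    exact hlt.not_ge (Finset.min'_le _ _ (Finset.mem_filter.2 ⟨hy, not_lt.1 hjy⟩))⟩
  conn_self i s := Subtype.ext (Finset.filter_true_of_mem s.2.2)
  conn_conn {k j i} hkj hji s := Subtype.ext (by
    ext x
    simp only [Finset.mem_filter]
    constructor
    · rintro ⟨⟨hx, h1⟩, h2⟩
      exact ⟨hx, fun y hy hyx => h2 y ⟨hy, fun z hz hzy => h1 z hz (hzy.trans hyx)⟩ hyx⟩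
    · rintro ⟨hx, h1⟩
      exact ⟨⟨hx, fun y hy hyx => (h1 y hy hyx).trans_le hkj⟩, fun y hy hyx => h1 y hy.1 hyx⟩)

variable {I}

theorem finsetTree_nonempty (i : I) : Nonempty ((finsetTree I).level i) :=
  ⟨⟨{i}, ⟨i, by simp⟩, by simp⟩⟩

/-- If `s` has no element `≥ i`, add `i`: restriction to `j` discards it again, because `s` has an
element `≥ j` below `i`. -/
theorem finsetTree_surjective (j i : I) (h : j ≤ i) :
    Function.Surjective ((finsetTree I).conn h) := by
  rintro ⟨s, ⟨x, hx, hjx⟩, hs⟩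
  by_cases hi : ∃ x ∈ s, i ≤ x
  · exact ⟨⟨s, hi, fun x hx y hy hyx => (hs x hx y hy hyx).trans_le h⟩,
      Subtype.ext (Finset.filter_true_of_mem hs)⟩
  · push Not at hi
    refine ⟨⟨insert i s, ⟨i, Finset.mem_insert_self _ _, le_rfl⟩, ?_⟩, Subtype.ext ?_⟩
    · intro x hx y hy hyx
      rcases Finset.mem_insert.1 hy with rfl | hy
      · rcases Finset.mem_insert.1 hx with rfl | hx
        exacts [hyx, absurd hyx (hi x hx).not_gt]
      · exact hi y hy
    · change (insert i s).filter _ = s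
      ext y
      simp only [Finset.mem_filter, Finset.mem_insert]
      constructor
      · rintro ⟨rfl | hy, h'⟩
        · exact absurd (h' x (Or.inr hx) (hi x hx)) hjx.not_gt
        · exact hy
      · refine fun hy => ⟨Or.inr hy, ?_⟩
        rintro z (rfl | hz) hzy
        · exact absurd hzy (hi y hy).not_gt
        · exact hs y hy z hz hzy

/-- In a full branch, the finite set at `b` contains those at all earlier indices. Choosing elements
ever further up gives a strictly increasing sequence; if `b` bounds it, the set at `b` is infinite.
-/
theorem finsetTree_isEmpty_fullBranch [Nonempty I] [NoMaxOrder I]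
    (hI : ∀ f : ℕ → I, StrictMono f → ∃ b, ∀ n, f n ≤ b) : IsEmpty (finsetTree I).FullBranch := by
  refine ⟨fun ⟨s, hs⟩ => ?_⟩
  choose m hm him using fun i => (s i).2.1
  choose g hg using fun i => exists_gt (m i)
  let x : ℕ → I := fun n => g^[n] (Classical.arbitrary I)
  have hx : ∀ n, x (n + 1) = g (x n) := fun n => Function.iterate_succ_apply' _ _ _
  have hmono : StrictMono fun n => m (x n) := strictMono_nat_of_lt_succ fun n => by
    rw [hx]
    exact (hg _).trans_le (him _)
  obtain ⟨b, hb⟩ := hI _ hmono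
  refine Set.infinite_of_injective_forall_mem hmono.injective (fun n => ?_)
    (s b).1.finite_toSet
  have hle : x n ≤ b := (him _).trans (hb n)
  have h1 := hm (x n)
  rw [← hs _ _ hle] at h1
  exact (Finset.mem_filter.1 h1).1

end FiniteSets

/-! ### Limits below `κ` with surjective connecting map are weakly compact -/

section NonSurjectivity

variable {κ : WithTop Cardinal.{u}} {l θ : Ordinal.{u}}

theorem isSuccLimit_of_ne_zero (hl : IsSuccPrelimit l) (h0 : l ≠ 0) : IsSuccLimit l :=
  ⟨by simpa [isMin_iff_eq_bot] using h0, hl⟩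

theorem aleph0_lt_of_card_lt (hl : IsSuccPrelimit l) (h0 : l ≠ 0)
    (hlκ : (l.card : WithTop Cardinal) < κ) : (ℵ₀ : WithTop Cardinal) < κ :=
  lt_of_le_of_lt (WithTop.coe_le_coe.2 (Ordinal.aleph0_le_card.2
    (Ordinal.omega0_le_of_isSuccLimit (isSuccLimit_of_ne_zero hl h0)))) hlκ

theorem card_succ_lt (hl : IsSuccPrelimit l) (h0 : l ≠ 0)
    (hlκ : (l.card : WithTop Cardinal) < κ) : ((succ l).card : WithTop Cardinal) < κ := by
  have h := Ordinal.aleph0_le_card.2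
    (Ordinal.omega0_le_of_isSuccLimit (isSuccLimit_of_ne_zero hl h0))
  rwa [Order.succ_eq_add_one, Ordinal.card_add_one, Cardinal.add_one_eq h]

/-- If `l` is not `ω`-cofinal, and has a cofinal subset of size at most `2 ^ |θ|` for some `θ < l`,
then the connecting map at `l` is not surjective. -/
theorem not_surjAt_of_isCofinal (hκ : IsRegularOrTop κ) (hl : IsSuccPrelimit l) (h0 : l ≠ 0)
    (hlκ : (l.card : WithTop Cardinal) < κ) (hω : ¬ IsOmegaCofinal l) (hθ : θ < l)
    {S : Set l.ToType} (hS : IsCofinal S) (hSθ : #S ≤ 2 ^ θ.card) : ¬ SurjAt κ l := by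
  let val : l.ToType → Ordinal.{u} := fun x => (Ordinal.ToType.mk.symm x).1
  have hval : StrictMono val := fun x y h => Ordinal.ToType.mk.symm.strictMono h
  have hvall : ∀ x, val x < l := fun x => (Ordinal.ToType.mk.symm x).2
  -- Discarding the part of `S` below `θ` makes subsets of `θ` admissible as labels at every level.
  let I : Type u := {x : S // θ ≤ val x.1}
  have hmono : StrictMono fun x : I => val x.1.1 := fun x y h => hval h
  have hcof : ∀ j < l, ∃ i : I, j ≤ val i.1.1 := by
    intro j hj
    obtain ⟨x, hx, hjx⟩ := hS (Ordinal.ToType.mk ⟨max j θ, max_lt hj hθ⟩)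
    have hle : max j θ ≤ val x := by
      have := hval.monotone hjx
      simpa [val] using this
    exact ⟨⟨⟨x, hx⟩, (le_max_right _ _).trans hle⟩, (le_max_left _ _).trans hle⟩
  have hne : Nonempty I := ⟨(hcof 0 (pos_iff_ne_zero.2 h0)).choose⟩
  have hmax : NoMaxOrder I := ⟨fun x => by
    obtain ⟨y, hy⟩ := hcof _ (hl.succ_lt (hvall x.1.1))
    exact ⟨y, hmono.lt_iff_lt.1 ((lt_succ _).trans_le hy)⟩⟩
  have hinf : Infinite I := NoMaxOrder.infinite
  have hIS : #(Finset I) ≤ #S := by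
    rw [mk_finset_of_infinite]
    exact mk_subtype_le _
  -- This is where the bound `2 ^ |θ|` enters: there are enough subsets of `θ` to label all nodes.
  obtain ⟨e⟩ : Nonempty (Finset I ↪ Set θ.ToType) := by
    rw [← Cardinal.le_def, mk_set, Cardinal.mk_toType]
    exact hIS.trans hSθ
  have hFκ : (#(Finset I) : WithTop Cardinal) < κ := by
    refine lt_of_le_of_lt (WithTop.coe_le_coe.2 (hIS.trans (mk_set_le S))) ?_
    rwa [Cardinal.mk_toType]
  let θval : θ.ToType → Ordinal.{u} := fun x => (Ordinal.ToType.mk.symm x).1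
  have hθval : Function.Injective θval :=
    Subtype.val_injective.comp Ordinal.ToType.mk.symm.injective
  have hsub : ∀ B : Set θ.ToType, θval '' B ⊆ Set.Iio θ := by
    rintro B _ ⟨x, -, rfl⟩
    exact (Ordinal.ToType.mk.symm x).2
  let T : TreeCode (finsetTree I) l (Finset I) :=
    { c := fun x => val x.1.1
      strictMono := hmono
      lt := fun x => hvall _
      cofinal := hcof
      label := fun s => θval '' e s
      label_subset := fun s => (hsub _).trans (Set.Iio_subset_Iio hθ.le)
      code := fun _ d => d.1
      code_subset := fun i d => (hsub _).trans (Set.Iio_subset_Iio i.2)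
      code_injective := fun i d d' h => Subtype.ext (e.injective (hθval.image_injective h)) }
  refine T.not_surjAt hκ hl (card_succ_lt hl h0 hlκ) hFκ (aleph0_lt_of_card_lt hl h0 hlκ)
    finsetTree_surjective finsetTree_nonempty (fun i => ?_) (finsetTree_isEmpty_fullBranch ?_)
  · exact lt_of_le_of_lt (WithTop.coe_le_coe.2 (mk_subtype_le _)) hFκ
  · intro f hf
    have hf' : StrictMono fun n => val (f n).1.1 := hmono.comp hf
    obtain ⟨b, hb, hbl⟩ : ∃ b < l, ∀ n, val (f n).1.1 ≤ b := by
      by_contra! hcon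
      refine hω ⟨_, hf', ?_, ?_⟩
      · rintro _ ⟨n, rfl⟩
        exact (hvall _).le
      · intro b hb
        by_contra! hbl
        obtain ⟨n, hn⟩ := hcon b hbl
        exact hn.not_ge (hb ⟨n, rfl⟩)
    obtain ⟨i, hi⟩ := hcof b hb
    exact ⟨i, fun n => hmono.le_iff_le.1 ((hbl n).trans hi)⟩

/-- Failure of the tree property at a regular cardinal obstructs surjectivity. -/
theorem not_surjAt_of_not_hasTreeProperty (hκ : IsRegularOrTop κ) {c : Cardinal.{u}}
    (hc : c.IsRegular) (hcκ : (c : WithTop Cardinal) < κ) (ht : ¬ HasTreeProperty c) :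
    ¬ SurjAt κ c.ord := by
  unfold HasTreeProperty at ht
  push Not at ht
  obtain ⟨D, hD, hDc, hbr⟩ := ht
  have hl : IsSuccPrelimit c.ord := (isSuccLimit_ord hc.aleph0_le).isSuccPrelimit
  have h0 : c.ord ≠ 0 := hc.ord_pos.ne'
  have hlκ : (c.ord.card : WithTop Cardinal) < κ := by simpa using hcκ
  have hmono : ∀ i j : Set.Iio c.ord, i ≤ j → (#(D.level i)).ord ≤ (#(D.level j)).ord :=
    fun i j h => ord_le_ord.2 (mk_le_of_surjective (hD.surjective i j h))
  have hlev : ∀ i : Set.Iio c.ord, (#(D.level i)).ord < c.ord := fun i => ord_lt_ord.2 (hDc i)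
  have hcode : ∀ i, Nonempty (D.level i ≃ (#(D.level i)).ord.ToType) := fun i =>
    Cardinal.eq.1 (mk_ord_toType _).symm
  let e := fun i => (hcode i).some
  let val : c.ord.ToType → Ordinal.{u} := fun x => (Ordinal.ToType.mk.symm x).1
  let code : ∀ i, D.level i → c.ord.ToType := fun i d =>
    Ordinal.ToType.mk ⟨(Ordinal.ToType.mk.symm (e i d)).1,
      Set.Iio_subset_Iio (hlev i).le (Ordinal.ToType.mk.symm (e i d)).2⟩
  have hval : ∀ i d, val (code i d) = (Ordinal.ToType.mk.symm (e i d)).1 := fun i d => by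
    simp [val, code]
  let T : TreeCode D c.ord c.ord.ToType :=
    -- The first summand exceeds every ordinal that labels a node at `i` and is monotone because
    -- connecting maps are surjective; the second makes the sum strictly increasing and cofinal. The
    -- sum stays below `c.ord`, which is closed under addition.
    { c := fun i => (#(D.level i)).ord + i.1
      strictMono := fun i j h => (add_lt_add_right (show i.1 < j.1 from h) _).trans_le
        (add_le_add_left (hmono i j h.le) _)
      lt := fun i => Ordinal.isPrincipal_add_ord hc.aleph0_le (hlev i) i.2
      cofinal := fun j hj => ⟨⟨j, hj⟩, le_add_self⟩
      label := fun x => {val x}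
      label_subset := fun x => Set.singleton_subset_iff.2 (Ordinal.ToType.mk.symm x).2
      code := code
      code_subset := fun i d => Set.singleton_subset_iff.2 (by
        rw [hval]
        exact Set.Iio_subset_Iio le_self_add (Ordinal.ToType.mk.symm (e i d)).2)
      code_injective := fun i d d' h => by
        rw [Set.singleton_eq_singleton_iff, hval, hval] at h
        exact (e i).injective (Ordinal.ToType.mk.symm.injective (Subtype.ext h)) }
  refine T.not_surjAt hκ hl (card_succ_lt hl h0 hlκ) (by simpa using hcκ)
    (aleph0_lt_of_card_lt hl h0 hlκ) hD.surjective hD.nonempty (fun i => ?_) hbr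
  exact (WithTop.coe_lt_coe.2 (hDc i)).trans hcκ

/-- Every cofinal `S` satisfies `2 ^ |θ| < |S|` for all `θ < l`. Taking `S` to be everything makes
`l` a strong limit cardinal; taking `S` of size `cof l`, and `θ = cof l` if that were smaller than
`l`, contradicts Cantor's theorem, so `l` is regular. -/
theorem exists_isWeaklyCompact_of_surjAt (hκ : IsRegularOrTop κ) (hl : IsSuccPrelimit l)
    (h0 : l ≠ 0) (hlκ : (l.card : WithTop Cardinal) < κ) (hω : ¬ IsOmegaCofinal l)
    (hs : SurjAt κ l) : ∃ c : Cardinal.{u}, l = c.ord ∧ IsWeaklyCompact c := by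
  have key : ∀ θ < l, ∀ S : Set l.ToType, IsCofinal S → 2 ^ θ.card < #S := by
    intro θ hθ S hS
    by_contra! hSθ
    exact not_surjAt_of_isCofinal hκ hl h0 hlκ hω hθ hS hSθ hs
  have huniv : ∀ θ < l, 2 ^ θ.card < l.card := fun θ hθ => by
    simpa using key θ hθ Set.univ IsCofinal.univ
  have hord : l.card.ord = l := by
    refine (ord_card_le l).eq_of_not_lt fun h => ?_
    have := huniv _ h
    rw [card_ord] at this
    exact this.not_gt (cantor _)
  have hreg : l.card.IsRegular := by
    refine ⟨Ordinal.aleph0_le_card.2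
      (Ordinal.omega0_le_of_isSuccLimit (isSuccLimit_of_ne_zero hl h0)), ?_⟩
    rw [hord]
    by_contra! h
    obtain ⟨S, hS, hS'⟩ := Order.exists_cof_eq l.ToType
    have := key l.cof.ord (by rwa [← hord, ord_lt_ord, hord]) S hS
    rw [hS', Ordinal.cof_toType, card_ord] at this
    exact this.not_gt (cantor _)
  refine ⟨l.card, hord.symm, hreg, fun A hA => ?_, ?_⟩
  · have := huniv (#A).ord (by rwa [← hord, ord_lt_ord])
    rwa [card_ord, ← mk_set] at this
  · by_contra ht
    refine not_surjAt_of_not_hasTreeProperty hκ hreg hlκ ht ?_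
    rwa [hord]

end NonSurjectivity

/-! ### Classification of limits and conclusion -/

theorem surjAt_iff_isSurjectivityLimit {κ : WithTop Cardinal.{u}} (hκ : IsRegularOrTop κ)
    {l : Ordinal.{u}} (hl : IsSuccPrelimit l) : SurjAt κ l ↔ IsSurjectivityLimit κ l := by
  -- A limit beyond `κ` is at least `κ + ω`, so these three ranges are exhaustive.
  have hcases : (l.card : WithTop Cardinal) < κ ∨ (∃ c : Cardinal.{u}, κ = c ∧ l = c.ord) ∨
      ∃ c : Cardinal.{u}, κ = c ∧ c.ord + Ordinal.omega0 ≤ l := by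
    cases κ with
    | top => exact Or.inl (WithTop.coe_lt_top _)
    | coe c =>
      rcases lt_trichotomy l c.ord with h | h | h
      · exact Or.inl (WithTop.coe_lt_coe.2 (lt_ord.1 h))
      · exact Or.inr (Or.inl ⟨c, rfl, h⟩)
      · refine Or.inr (Or.inr ⟨c, rfl, ?_⟩)
        refine ((Ordinal.isNormal_add_right c.ord).le_iff_forall_le Ordinal.isSuccLimit_omega0).2 ?_
        intro a ha
        obtain ⟨n, rfl⟩ := Ordinal.lt_omega0.1 ha
        suffices hn : c.ord + n < l from hn.le
        clear ha
        induction n with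
        | zero => simpa using h
        | succ n ih => simpa [← add_assoc, Order.succ_eq_add_one] using hl.succ_lt ih
  constructor
  · intro hs
    refine ⟨?_, ?_⟩
    · rcases hcases with h | ⟨c, rfl, rfl⟩ | h
      · by_contra! hcon
        obtain ⟨c, hc, hw⟩ := exists_isWeaklyCompact_of_surjAt hκ hl hcon.1 h hcon.2.1 hs
        exact hcon.2.2.1 c hc hw
      · exact absurd hs (not_surjAt_ord hκ)
      · exact Or.inr (Or.inr (Or.inr h))
    · rintro c rfl rfl
      exact not_surjAt_ord hκ hs
  · rintro ⟨hgood, hne⟩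
    rcases hcases with h | ⟨c, rfl, rfl⟩ | ⟨c, rfl, hle⟩
    · rcases hgood with rfl | hω | ⟨c, rfl, hc⟩ | ⟨c, rfl, hle⟩
      · exact surjAt_zero hκ
      · exact surjAt_of_isOmegaCofinal hκ hl h hω
      · exact surjAt_of_isWeaklyCompact hκ (by simpa using h) hc
      · exact surjAt_of_ord_add_omega0_le (hκ c rfl) hle
    · exact absurd rfl (hne c rfl)
    · exact surjAt_of_ord_add_omega0_le (hκ c rfl) hle

end FinalChain

end

theorem proposition7p18 (κ : WithTop Cardinal.{u}) (hκ : FinalChain.IsRegularOrTop κ) :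
    (∀ (j i : Ordinal.{u}) (h : j ≤ i),
      Function.Surjective ((FinalChain.finalChain κ).conn h) ↔
        j = i ∨ FinalChain.IsSurjectivityLimit κ (FinalChain.limitPart j)) ∧
    (∀ i : Ordinal.{u},
      (∀ a : (FinalChain.finalChain κ).level i, FinalChain.IsCoalgebraic a) ↔
        FinalChain.IsSurjectivityLimit κ (FinalChain.limitPart i)) := by
  have key : ∀ i, FinalChain.SurjAt κ i ↔
      FinalChain.IsSurjectivityLimit κ (FinalChain.limitPart i) := fun i =>
    (FinalChain.surjAt_iff_limitPart hκ).trans (FinalChain.surjAt_iff_isSurjectivityLimit hκ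
      ((FinalChain.limitPart_eq_iff i _).1 rfl).1)
  exact ⟨fun j i h => (FinalChain.surjective_restr_iff h).trans (or_congr_right (key j)),
    fun i => FinalChain.forall_isCoalgebraic_iff.trans (key i)⟩
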